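/- Let $0<r_1<r_2$ and let $0\le u_0\in L^1(\mathbb R^2)\cap L^\infty(\mathbb R^2)$ be such that $u_0(x)=u_0(|x|)$ is radial and monotone decreasing (i.e. non-increasing) on $|x|\ge r_1$, and $$\operatorname*{ess\,inf}_{\overline B_{r_1}(0)}u_0\ \ge\ \operatorname*{ess\,sup}_{\mathbb R^2\setminus B_{r_2}(0)}u_0 .$$ Put $T=\frac1{4\pi}\int_{\mathbb R^2}u_0\,dx$ and let $u$ be the maximal solution of $$u_t=\Delta\log u,\quad u>0\quad\text{in }\mathbb R^2\times(0,T),\qquad u(x,0)=u_0(x)\quad\text{in }\mathbb R^2,$$ that is, $u$ is a classical ($C^{2,1}$) solution, $u(\cdot,t)\to u_0$ in $L^1_{\mathrm{loc}}(\mathbb R^2)$ as $t\to0^+$, and $u$ satisfies $$\int_{\mathbb R^2}u(x,t)\,dx=\int_{\mathbb R^2}u_0\,dx-4\pi t\qquad\text{for all }0<t<T .$$ Then $$u(x,t)\ge u(y,t)\qquad\text{for all }t\in(0,T)\text{ and all }x,y\in\mathbb R^2\text{ with }|y|\ge|x|+2r_2 .$$ Consequently, for every $t\in(0,T)$ there is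 $x_t\in\overline B_{2r_2}(0)$ with $u(x_t,t)=\max_{x\in\mathbb R^2}u(x,t)$. -/

import Mathlib

open Set MeasureTheory Filter Topology

noncomputable section

namespace LogDiffusion

/-- The Euclidean plane. -/
abbrev Plane : Type := EuclideanSpace ℝ (Fin 2)

/-- `u` (written `u x t`) is a positive classical (that is, `C^{2,1}`) solution of
`u_t = Δ log u` in `ℝ² × (0,T)`; the Laplacian acts on the space variable only.
Values of `u x t` for `t ∉ (0,T)` play no role. -/
structure IsClassicalSolution (u : Plane → ℝ → ℝ) (T : ℝ) : Prop where
  pos : ∀ x : Plane, ∀ t ∈ Ioo (0 : ℝ) T, 0 < u x t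
  contDiff_space : ∀ t ∈ Ioo (0 : ℝ) T, ContDiff ℝ 2 (fun x : Plane => u x t)
  differentiableAt_time : ∀ x : Plane, ∀ t ∈ Ioo (0 : ℝ) T, DifferentiableAt ℝ (fun s => u x s) t
  continuousOn : ContinuousOn (fun p : Plane × ℝ => u p.1 p.2) (univ ×ˢ Ioo (0 : ℝ) T)
  continuousOn_fderiv :
    ContinuousOn (fun p : Plane × ℝ => fderiv ℝ (fun x : Plane => u x p.2) p.1)
      (univ ×ˢ Ioo (0 : ℝ) T)
  continuousOn_fderiv_fderiv :
    ContinuousOn (fun p : Plane × ℝ => fderiv ℝ (fderiv ℝ (fun x : Plane => u x p.2)) p.1)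
      (univ ×ˢ Ioo (0 : ℝ) T)
  continuousOn_deriv :
    ContinuousOn (fun p : Plane × ℝ => deriv (fun s => u p.1 s) p.2) (univ ×ˢ Ioo (0 : ℝ) T)
  equation : ∀ x : Plane, ∀ t ∈ Ioo (0 : ℝ) T,
    deriv (fun s => u x s) t = Laplacian.laplacian (fun y : Plane => Real.log (u y t)) x

/-- `u(·,0) = u₀`, in the sense that `u(·,t) → u₀` in `L¹_loc(ℝ²)` as `t ↓ 0`. -/
def HasInitialValue (u : Plane → ℝ → ℝ) (u₀ : Plane → ℝ) : Prop :=
  ∀ K : Set Plane, IsCompact K →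
    Tendsto (fun t : ℝ => eLpNorm (fun x => u x t - u₀ x) 1 (volume.restrict K)) (𝓝[>] 0) (𝓝 0)

/-- The mass loss law `∫ u(x,t) dx = ∫ u₀ dx - 2π ∫₀ᵗ f(s) ds` for `0 < t < T`
(including the finiteness of the mass at each time). -/
def SatisfiesMassLoss (u : Plane → ℝ → ℝ) (u₀ : Plane → ℝ) (f : ℝ → ℝ) (T : ℝ) : Prop :=
  ∀ t ∈ Ioo (0 : ℝ) T, Integrable (fun x : Plane => u x t) ∧
    ∫ x : Plane, u x t = (∫ x : Plane, u₀ x) - 2 * Real.pi * ∫ s in (0 : ℝ)..t, f s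

/-- The maximal solution of `u_t = Δ log u`, `u > 0`, `u(·,0) = u₀` with finite mass, up to its
extinction time `T = (1/4π) ∫ u₀`: it is the solution whose mass is lost at the rate given by
`f ≡ 2`. -/
structure IsMaximalSolution (u : Plane → ℝ → ℝ) (u₀ : Plane → ℝ) (T : ℝ) : Prop where
  classical : IsClassicalSolution u T
  initial : HasInitialValue u u₀
  massLoss : SatisfiesMassLoss u u₀ (fun _ => 2) T
  extinction : T = 1 / (4 * Real.pi) * ∫ x : Plane, u₀ x

/-- `u₀(x) = u₀(|x|)` is radial and monotone decreasing (in the weak sense) on `|x| ≥ r₁`. -/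
def IsRadialDecreasingFrom (u₀ : Plane → ℝ) (r₁ : ℝ) : Prop :=
  ∃ φ : ℝ → ℝ, AntitoneOn φ (Ici r₁) ∧ ∀ x : Plane, r₁ ≤ ‖x‖ → u₀ x = φ ‖x‖

end LogDiffusion

end

/-! The proof is a reflection argument. Given `‖x‖ + 2 * r₂ ≤ ‖y‖`, let `σ` be the reflection in the
bisector of `x` and `y`, and `H` the open half plane containing `x`. The bisector has distance at
least `r₂` from the origin, so `σ` maps `H` outside the ball of radius `r₂` and moves its points
away from the origin; hence `u₀ ∘ σ ≤ u₀` a.e. on `H` (`ae_comp_planeReflection_le`). The function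
`u ∘ σ` solves the same equation and equals `u` on the bisector, so a comparison principle on `H`
gives `u y t = u (σ x) t ≤ u x t`.

The difficulty is comparison on an unbounded set: the equation has many solutions with the same
initial value, and the mass loss law must single out the maximal one. Kato's inequality bounds the
growth of `∫_H (v - u)₊ φ` by the space-time integral over `H` of `(log v - log u)₊ Δφ`
(`integral_posPart_le`). For `φ` take a cutoff that is affine in `log ‖x‖²` away from two annuli;
the logarithm is harmonic in the plane, so `Δφ` lives on these annuli and carries a factor `1/N`.
Testing the equation with `φ` and using the loss rate `4π`, which is the mass of `Δ log ‖x‖²`, shows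
that the mean of `|log (u ‖x‖²)|` over the outer annulus is `o(N)`
(`tendsto_integral_abs_logExcess`). The error at infinity therefore vanishes, and `∫_H (v - u)₊` is
nonincreasing in time (`integral_posPart_antitone`).

At time zero this quantity tends to zero because the local convergence to `u₀` improves to
convergence in `L¹` of the plane (`HasInitialValue.tendsto_integral_abs_sub`). -/

namespace LogDiffusion

/-! ### A smooth convex ramp -/

/-- A continuous bump supported in `[0, 1]`, of integral `1`. -/
noncomputable def rampBump (x : ℝ) : ℝ := max 0 (6 * (x * (1 - x)))

/-- The primitive of `rampBump`, which increases from `0` to `1`. -/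
noncomputable def rampSlope (x : ℝ) : ℝ := ∫ y in (0 : ℝ)..x, rampBump y

/-- A convex `C²` function that vanishes on `(-∞, 0]` and has slope `1` on `[1, ∞)`. -/
noncomputable def ramp (x : ℝ) : ℝ := ∫ y in (0 : ℝ)..x, rampSlope y

lemma continuous_rampBump : Continuous rampBump := by unfold rampBump; fun_prop

lemma rampBump_nonneg (x : ℝ) : 0 ≤ rampBump x := le_max_left _ _

lemma rampBump_le (x : ℝ) : rampBump x ≤ 2 :=
  max_le (by norm_num) (by nlinarith [sq_nonneg (x - 1 / 2)])

lemma rampBump_of_nonpos {x : ℝ} (hx : x ≤ 0) : rampBump x = 0 :=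
  max_eq_left (by nlinarith)

lemma rampBump_of_one_le {x : ℝ} (hx : 1 ≤ x) : rampBump x = 0 :=
  max_eq_left (by nlinarith)

lemma hasDerivAt_rampSlope (x : ℝ) : HasDerivAt rampSlope (rampBump x) x :=
  intervalIntegral.integral_hasDerivAt_right (continuous_rampBump.intervalIntegrable _ _)
    (continuous_rampBump.stronglyMeasurableAtFilter _ _) continuous_rampBump.continuousAt

lemma continuous_rampSlope : Continuous rampSlope :=
  continuous_iff_continuousAt.2 fun x => (hasDerivAt_rampSlope x).continuousAt

lemma hasDerivAt_ramp (x : ℝ) : HasDerivAt ramp (rampSlope x) x :=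
  intervalIntegral.integral_hasDerivAt_right (continuous_rampSlope.intervalIntegrable _ _)
    (continuous_rampSlope.stronglyMeasurableAtFilter _ _) continuous_rampSlope.continuousAt

lemma continuous_ramp : Continuous ramp :=
  continuous_iff_continuousAt.2 fun x => (hasDerivAt_ramp x).continuousAt

lemma contDiff_ramp : ContDiff ℝ 2 ramp := by
  have h1 : deriv ramp = rampSlope := funext fun x => (hasDerivAt_ramp x).deriv
  have h2 : deriv rampSlope = rampBump := funext fun x => (hasDerivAt_rampSlope x).deriv
  have h3 : ContDiff ℝ 1 rampSlope :=
    contDiff_one_iff_deriv.2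
      ⟨fun x => (hasDerivAt_rampSlope x).differentiableAt, h2 ▸ continuous_rampBump⟩
  have h4 : ContDiff ℝ (1 + 1) ramp :=
    contDiff_succ_iff_deriv.2
      ⟨fun x => (hasDerivAt_ramp x).differentiableAt, by simp, h1 ▸ h3⟩
  simpa [one_add_one_eq_two] using h4

lemma rampSlope_of_nonpos {x : ℝ} (hx : x ≤ 0) : rampSlope x = 0 := by
  unfold rampSlope
  rw [intervalIntegral.integral_congr (g := fun _ => (0 : ℝ)), intervalIntegral.integral_zero]
  intro y hy
  rw [uIcc_of_ge hx] at hy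
  exact rampBump_of_nonpos hy.2

lemma monotone_rampSlope : Monotone rampSlope :=
  monotone_of_hasDerivAt_nonneg hasDerivAt_rampSlope rampBump_nonneg

/-- The factor `6` in `rampBump` is chosen for this: on `[0, 1]` the bump has primitive `3 y² - 2
y³`. -/
lemma rampSlope_one : rampSlope 1 = 1 := by
  unfold rampSlope
  rw [intervalIntegral.integral_eq_sub_of_hasDerivAt (f := fun y : ℝ => 3 * y ^ 2 - 2 * y ^ 3) ?_
    (continuous_rampBump.intervalIntegrable _ _)]
  · norm_num
  · intro y hy
    rw [uIcc_of_le zero_le_one] at hy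
    have : 0 ≤ y * (1 - y) := mul_nonneg hy.1 (by linarith [hy.2])
    rw [rampBump, max_eq_right (by linarith)]
    have h := ((hasDerivAt_pow 2 y).const_mul 3).sub ((hasDerivAt_pow 3 y).const_mul 2)
    refine h.congr_deriv ?_
    norm_num
    ring

lemma rampSlope_of_one_le {x : ℝ} (hx : 1 ≤ x) : rampSlope x = 1 := by
  have h : ∫ y in (1 : ℝ)..x, rampBump y = 0 := by
    rw [intervalIntegral.integral_congr (g := fun _ => (0 : ℝ)), intervalIntegral.integral_zero]
    intro y hy
    rw [uIcc_of_le hx] at hy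
    exact rampBump_of_one_le hy.1
  have := intervalIntegral.integral_add_adjacent_intervals
    (continuous_rampBump.intervalIntegrable (μ := volume) 0 1)
    (continuous_rampBump.intervalIntegrable (μ := volume) 1 x)
  have h1 := rampSlope_one
  unfold rampSlope at h1 ⊢
  linarith

lemma rampSlope_nonneg (x : ℝ) : 0 ≤ rampSlope x := by
  rcases le_total x 0 with h | h
  · exact (rampSlope_of_nonpos h).ge
  · exact (rampSlope_of_nonpos le_rfl).ge.trans (monotone_rampSlope h)

lemma rampSlope_le_one (x : ℝ) : rampSlope x ≤ 1 := by
  rcases le_total x 1 with h | h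
  · exact (monotone_rampSlope h).trans_eq rampSlope_one
  · exact (rampSlope_of_one_le h).le

lemma ramp_of_nonpos {x : ℝ} (hx : x ≤ 0) : ramp x = 0 := by
  unfold ramp
  rw [intervalIntegral.integral_congr (g := fun _ => (0 : ℝ)), intervalIntegral.integral_zero]
  intro y hy
  rw [uIcc_of_ge hx] at hy
  exact rampSlope_of_nonpos hy.2

lemma monotone_ramp : Monotone ramp :=
  monotone_of_hasDerivAt_nonneg hasDerivAt_ramp rampSlope_nonneg

lemma ramp_nonneg (x : ℝ) : 0 ≤ ramp x := by
  rcases le_total x 0 with h | h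
  · exact (ramp_of_nonpos h).ge
  · exact (ramp_of_nonpos le_rfl).ge.trans (monotone_ramp h)

lemma ramp_sub_le {x y : ℝ} (h : x ≤ y) : ramp y - ramp x ≤ y - x := by
  have hm : Monotone fun x => x - ramp x :=
    monotone_of_hasDerivAt_nonneg (fun x => (hasDerivAt_id' x).sub (hasDerivAt_ramp x))
      fun x => sub_nonneg.2 (rampSlope_le_one x)
  have := hm h
  simp only at this
  linarith

lemma ramp_of_one_le {x : ℝ} (hx : 1 ≤ x) : ramp x = ramp 1 + (x - 1) := by
  have h : ∫ y in (1 : ℝ)..x, rampSlope y = x - 1 := by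
    rw [intervalIntegral.integral_congr (g := fun _ => (1 : ℝ))]
    · simp
    · intro y hy
      rw [uIcc_of_le hx] at hy
      exact rampSlope_of_one_le hy.1
  have := intervalIntegral.integral_add_adjacent_intervals
    (continuous_rampSlope.intervalIntegrable (μ := volume) 0 1)
    (continuous_rampSlope.intervalIntegrable (μ := volume) 1 x)
  unfold ramp
  linarith

lemma ramp_le_max (x : ℝ) : ramp x ≤ max x 0 := by
  rcases le_total x 0 with h | h
  · rw [ramp_of_nonpos h]; exact le_max_right _ _
  · have := ramp_sub_le h
    rw [ramp_of_nonpos le_rfl] at this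
    exact le_max_of_le_left (by linarith)

/-! ### The Laplacian -/

section Laplacian

open InnerProductSpace

variable {E : Type*} [NormedAddCommGroup E] [InnerProductSpace ℝ E] [FiniteDimensional ℝ E]

lemma laplacian_eq_sum_fderiv {ι : Type*} [Fintype ι] (v : OrthonormalBasis ι ℝ E) (f : E → ℝ)
    (x : E) : Laplacian.laplacian f x = ∑ i, fderiv ℝ (fderiv ℝ f) x (v i) (v i) := by
  rw [laplacian_eq_iteratedFDeriv_orthonormalBasis f v]
  simp [iteratedFDeriv_two_apply]

/-- The chain rule for the Laplacian of `j ∘ f`. -/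
lemma laplacian_comp {ι : Type*} [Fintype ι] (v : OrthonormalBasis ι ℝ E) {f : E → ℝ}
    {j j' : ℝ → ℝ} {j'' : ℝ} {x : E} (hf : ContDiffAt ℝ 2 f x)
    (hj : ∀ᶠ y in 𝓝 (f x), HasDerivAt j (j' y) y) (hj' : HasDerivAt j' j'' (f x)) :
    Laplacian.laplacian (fun y => j (f y)) x =
      j' (f x) * Laplacian.laplacian f x + j'' * ∑ i, (fderiv ℝ f x (v i)) ^ 2 := by
  have hd : ∀ᶠ y in 𝓝 x, DifferentiableAt ℝ f y :=
    (hf.eventually (by simp)).mono fun y hy => hy.differentiableAt (by simp)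
  have h1 : fderiv ℝ (fun y => j (f y)) =ᶠ[𝓝 x] fun y => j' (f y) • fderiv ℝ f y := by
    filter_upwards [hd, hf.continuousAt.eventually hj] with y hy hjy
    exact (hjy.comp_hasFDerivAt y hy.hasFDerivAt).fderiv
  have hff : DifferentiableAt ℝ (fderiv ℝ f) x :=
    (hf.fderiv_right (m := 1) (by norm_num)).differentiableAt (by simp)
  have h2 : HasFDerivAt (fun y => j' (f y) • fderiv ℝ f y)
      (j' (f x) • fderiv ℝ (fderiv ℝ f) x + (j'' • fderiv ℝ f x).smulRight (fderiv ℝ f x)) x :=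
    (hj'.comp_hasFDerivAt x hd.self_of_nhds.hasFDerivAt).smul hff.hasFDerivAt
  rw [laplacian_eq_sum_fderiv v, laplacian_eq_sum_fderiv v, h1.fderiv_eq, h2.fderiv,
    Finset.mul_sum, Finset.mul_sum, ← Finset.sum_add_distrib]
  refine Finset.sum_congr rfl fun i _ => ?_
  simp
  ring

/-- The Laplacian can be computed in any orthonormal basis: use a basis on the left and its image
under `ρ` on the right. -/
lemma laplacian_comp_linearIsometryEquiv (ρ : E ≃ₗᵢ[ℝ] E) (f : E → ℝ) (x : E) :
    Laplacian.laplacian (fun y => f (ρ y)) x = Laplacian.laplacian f (ρ x) := by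
  rw [laplacian_eq_iteratedFDeriv_orthonormalBasis _ (stdOrthonormalBasis ℝ E),
    laplacian_eq_iteratedFDeriv_orthonormalBasis _ ((stdOrthonormalBasis ℝ E).map ρ)]
  have h := ρ.toContinuousLinearEquiv.iteratedFDerivWithin_comp_right (𝕜 := ℝ) f
    uniqueDiffOn_univ (x := x) (mem_univ _) 2
  rw [preimage_univ, iteratedFDerivWithin_univ, iteratedFDerivWithin_univ] at h
  have h' : (f ∘ ρ.toContinuousLinearEquiv) = fun y => f (ρ y) := rfl
  rw [h'] at h
  refine Finset.sum_congr rfl fun i _ => ?_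
  rw [h]
  simp only [ContinuousMultilinearMap.compContinuousLinearMap_apply]
  congr 1
  ext k
  fin_cases k <;> rfl

/-- The Laplacian commutes with affine isometries. -/
lemma laplacian_comp_affine (ρ : E ≃ₗᵢ[ℝ] E) (c d : E) (f : E → ℝ) (x : E) :
    Laplacian.laplacian (fun y => f (ρ (y - c) + d)) x =
      Laplacian.laplacian f (ρ (x - c) + d) := by
  have h0 : ∀ (g : E → ℝ) (a z : E),
      Laplacian.laplacian (fun y => g (y + a)) z = Laplacian.laplacian g (z + a) := by
    intro g a z
    simp only [laplacian_eq_iteratedFDeriv_stdOrthonormalBasis, iteratedFDeriv_comp_add_right]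
  have h1 := h0 (fun y => f (ρ y + d)) (-c) x
  simp only [← sub_eq_add_neg] at h1
  rw [h1, laplacian_comp_linearIsometryEquiv ρ (fun y => f (y + d)) (x - c), h0]

lemma continuous_laplacian {f : E → ℝ} (hf : ContDiff ℝ 2 f) :
    Continuous (Laplacian.laplacian f) := by
  have : Laplacian.laplacian f = fun x => ∑ i, fderiv ℝ (fderiv ℝ f) x
      (stdOrthonormalBasis ℝ E i) (stdOrthonormalBasis ℝ E i) :=
    funext fun x => laplacian_eq_sum_fderiv _ f x
  rw [this]
  have h2 : Continuous (fderiv ℝ (fderiv ℝ f)) :=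
    (hf.fderiv_right (m := 1) (by norm_num)).continuous_fderiv (by simp)
  fun_prop

lemma laplacian_of_notMem_tsupport {f : E → ℝ} {x : E} (hx : x ∉ tsupport f) :
    Laplacian.laplacian f x = 0 := by
  have : f =ᶠ[𝓝 x] fun _ => 0 := notMem_tsupport_iff_eventuallyEq.1 hx
  rw [(laplacian_congr_nhds this).self_of_nhds, laplacian_const]
  rfl

variable [MeasurableSpace E] [BorelSpace E]

/-- Green's second identity against a compactly supported function. -/
lemma integral_mul_laplacian_comm {f φ : E → ℝ} (hf : ContDiff ℝ 2 f) (hφ : ContDiff ℝ 2 φ)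
    (hc : HasCompactSupport φ) :
    ∫ x, f x * Laplacian.laplacian φ x = ∫ x, Laplacian.laplacian f x * φ x := by
  have hf1 : ContDiff ℝ 1 (fderiv ℝ f) := hf.fderiv_right (by norm_num)
  have hφ1 : ContDiff ℝ 1 (fderiv ℝ φ) := hφ.fderiv_right (by norm_num)
  have cf := hf.continuous
  have cφ := hφ.continuous
  have cf1 := hf1.continuous
  have cφ1 := hφ1.continuous
  have cf2 : Continuous (fderiv ℝ (fderiv ℝ f)) := hf1.continuous_fderiv (by simp)
  have cφ2 : Continuous (fderiv ℝ (fderiv ℝ φ)) := hφ1.continuous_fderiv (by simp)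
  have hc1 : HasCompactSupport (fderiv ℝ φ) := hc.fderiv ℝ
  have hc2 : HasCompactSupport (fderiv ℝ (fderiv ℝ φ)) := hc1.fderiv ℝ
  set v := stdOrthonormalBasis ℝ E
  have e : ∀ (g : E → ℝ) (hg : ContDiff ℝ 1 (fderiv ℝ g)) (w : E) (x : E),
      fderiv ℝ (fderiv ℝ g) x w w = fderiv ℝ (fun y => fderiv ℝ g y w) x w := by
    intro g hg w x
    rw [fderiv_clm_apply ((hg.differentiable (by simp)) x) (by fun_prop)]
    simp
  have i1 : ∀ w, Integrable (fun x => f x * fderiv ℝ φ x w) := fun w =>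
    (cf.mul (by fun_prop)).integrable_of_hasCompactSupport
      ((hc1.comp_left (g := fun L : E →L[ℝ] ℝ => L w) rfl).mul_left)
  have i2 : ∀ w, Integrable (fun x => f x * fderiv ℝ (fderiv ℝ φ) x w w) := fun w =>
    (cf.mul (by fun_prop)).integrable_of_hasCompactSupport
      ((hc2.comp_left (g := fun L : E →L[ℝ] E →L[ℝ] ℝ => L w w) rfl).mul_left)
  have i3 : ∀ w, Integrable (fun x => fderiv ℝ f x w * fderiv ℝ φ x w) := fun w =>
    (Continuous.mul (by fun_prop) (by fun_prop)).integrable_of_hasCompactSupport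
      ((hc1.comp_left (g := fun L : E →L[ℝ] ℝ => L w) rfl).mul_left)
  have i4 : ∀ w, Integrable (fun x => fderiv ℝ (fderiv ℝ f) x w w * φ x) := fun w =>
    (Continuous.mul (by fun_prop) cφ).integrable_of_hasCompactSupport hc.mul_left
  have i5 : ∀ w, Integrable (fun x => fderiv ℝ f x w * φ x) := fun w =>
    (Continuous.mul (by fun_prop) cφ).integrable_of_hasCompactSupport hc.mul_left
  simp only [laplacian_eq_sum_fderiv v, Finset.mul_sum, Finset.sum_mul]
  rw [integral_finsetSum _ fun i _ => i2 (v i), integral_finsetSum _ fun i _ => i4 (v i)]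
  refine Finset.sum_congr rfl fun i _ => ?_
  -- Two integrations by parts in each basis direction; every product contains `φ` or one of its
  -- derivatives, hence is integrable.
  have a1 := integral_mul_fderiv_eq_neg_fderiv_mul_of_integrable (μ := (volume : Measure E))
    (f := f) (g := fun y => fderiv ℝ φ y (v i)) (v := v i) (i3 _)
    (by simpa only [e φ hφ1] using i2 (v i)) (i1 _)
    (fun x _ => hf.differentiable (by simp) x)
    (fun x _ => (hφ1.clm_apply contDiff_const).differentiable (by simp) x)
  have a2 := integral_mul_fderiv_eq_neg_fderiv_mul_of_integrable (μ := (volume : Measure E))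
    (f := fun y => fderiv ℝ f y (v i)) (g := φ) (v := v i)
    (by simpa only [e f hf1] using i4 (v i)) (i3 _) (i5 _)
    (fun x _ => (hf1.clm_apply contDiff_const).differentiable (by simp) x)
    (fun x _ => hφ.differentiable (by simp) x)
  simp only [e φ hφ1, e f hf1]
  linarith

end Laplacian

/-! ### Logarithmic cutoff functions -/

section Profile

/-- The cutoff as a function of `log ‖x - c‖²`: equal to `1` on `(-∞, 0]`, and to `0` on
`[N + 1, ∞)`. -/
noncomputable def cutoffProfile (N l : ℝ) : ℝ := 1 - (ramp l - ramp (l - N)) / N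

lemma contDiff_cutoffProfile (N : ℝ) : ContDiff ℝ 2 (cutoffProfile N) := by
  have h1 := contDiff_ramp
  have h2 : ContDiff ℝ 2 fun l : ℝ => ramp (l - N) := h1.comp (contDiff_id.sub contDiff_const)
  exact contDiff_const.sub ((h1.sub h2).div_const N)

lemma hasDerivAt_cutoffProfile (N l : ℝ) :
    HasDerivAt (cutoffProfile N) (-((rampSlope l - rampSlope (l - N)) / N)) l := by
  have h1 := hasDerivAt_ramp l
  have h2 := (hasDerivAt_ramp (l - N)).comp_sub_const l N
  exact ((h1.sub h2).div_const N).const_sub 1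

lemma hasDerivAt_deriv_cutoffProfile (N l : ℝ) :
    HasDerivAt (fun l => -((rampSlope l - rampSlope (l - N)) / N))
      ((rampBump (l - N) - rampBump l) / N) l := by
  have h1 := hasDerivAt_rampSlope l
  have h2 := (hasDerivAt_rampSlope (l - N)).comp_sub_const l N
  refine ((h1.sub h2).div_const N).neg.congr_deriv ?_
  ring

lemma cutoffProfile_of_nonpos {N l : ℝ} (hN : 0 ≤ N) (hl : l ≤ 0) : cutoffProfile N l = 1 := by
  rw [cutoffProfile, ramp_of_nonpos hl, ramp_of_nonpos (by linarith)]
  simp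

/-- Past `N + 1` both ramps have slope one, and their difference is exactly the shift `N`. -/
lemma cutoffProfile_of_le {N l : ℝ} (hN : 0 < N) (hl : N + 1 ≤ l) : cutoffProfile N l = 0 := by
  rw [cutoffProfile, ramp_of_one_le (by linarith), ramp_of_one_le (x := l - N) (by linarith)]
  field_simp
  ring

lemma cutoffProfile_nonneg {N : ℝ} (hN : 0 < N) (l : ℝ) : 0 ≤ cutoffProfile N l := by
  have := ramp_sub_le (x := l - N) (y := l) (by linarith)
  have : (ramp l - ramp (l - N)) / N ≤ 1 := (div_le_one hN).2 (by linarith)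
  unfold cutoffProfile
  linarith

lemma cutoffProfile_le_one {N : ℝ} (hN : 0 < N) (l : ℝ) : cutoffProfile N l ≤ 1 := by
  have := monotone_ramp (show l - N ≤ l by linarith)
  have : 0 ≤ (ramp l - ramp (l - N)) / N := div_nonneg (by linarith) hN.le
  unfold cutoffProfile
  linarith

lemma tendsto_cutoffProfile (l : ℝ) :
    Tendsto (fun N => cutoffProfile N l) atTop (𝓝 1) := by
  have h : Tendsto (fun N : ℝ => 1 - ramp l / N) atTop (𝓝 (1 - 0)) :=
    tendsto_const_nhds.sub (tendsto_const_nhds.div_atTop tendsto_id)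
  rw [sub_zero] at h
  refine h.congr' ?_
  filter_upwards [eventually_ge_atTop l] with N hN
  rw [cutoffProfile, ramp_of_nonpos (x := l - N) (by linarith), sub_zero]

end Profile

/-- A logarithmic cutoff function around `c`. -/
noncomputable def cutoff (c : Plane) (N : ℝ) (x : Plane) : ℝ :=
  cutoffProfile N (Real.log (‖x - c‖ ^ 2))

/-- The weight `4 b(log ‖x - c‖² - a) / ‖x - c‖²`, carried by the annulus
`a ≤ log ‖x - c‖² ≤ a + 1`. -/
noncomputable def annulusWeight (c : Plane) (a : ℝ) (x : Plane) : ℝ :=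
  4 * rampBump (Real.log (‖x - c‖ ^ 2) - a) / ‖x - c‖ ^ 2

/-- The case `r = 0` is included through the convention `Real.log 0 = 0`, so the cutoffs take the
right value at their centre. -/
lemma log_sq_nonpos {r : ℝ} (h0 : 0 ≤ r) (h : r ≤ 1) : Real.log (r ^ 2) ≤ 0 :=
  Real.log_nonpos (by positivity) (pow_le_one₀ h0 h)

lemma contDiffAt_log_norm_sub_sq {c x : Plane} (h : x ≠ c) :
    ContDiffAt ℝ 2 (fun y : Plane => Real.log (‖y - c‖ ^ 2)) x := by
  have h1 : ContDiffAt ℝ 2 (fun y : Plane => ‖y - c‖ ^ 2) x :=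
    ((contDiff_id.sub contDiff_const).norm_sq ℝ).contDiffAt
  exact h1.log (pow_ne_zero 2 (norm_ne_zero_iff.2 (sub_ne_zero.2 h)))

lemma eventually_norm_sub_lt_one (c : Plane) : ∀ᶠ y in 𝓝 c, ‖y - c‖ < 1 := by
  filter_upwards [Metric.ball_mem_nhds c one_pos] with y hy
  rwa [← dist_eq_norm]

lemma contDiff_cutoff (c : Plane) {N : ℝ} (hN : 0 ≤ N) : ContDiff ℝ 2 (cutoff c N) := by
  rw [contDiff_iff_contDiffAt]
  intro x
  rcases eq_or_ne x c with rfl | hx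
  · refine (contDiffAt_const (c := (1 : ℝ))).congr_of_eventuallyEq ?_
    filter_upwards [eventually_norm_sub_lt_one x] with y hy
    exact cutoffProfile_of_nonpos hN (log_sq_nonpos (norm_nonneg _) hy.le)
  · exact (contDiff_cutoffProfile N).contDiffAt.comp x (contDiffAt_log_norm_sub_sq hx)

lemma cutoff_nonneg (c : Plane) {N : ℝ} (hN : 0 < N) (x : Plane) : 0 ≤ cutoff c N x :=
  cutoffProfile_nonneg hN _

lemma cutoff_le_one (c : Plane) {N : ℝ} (hN : 0 < N) (x : Plane) : cutoff c N x ≤ 1 :=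
  cutoffProfile_le_one hN _

lemma tendsto_cutoff (c x : Plane) : Tendsto (fun N => cutoff c N x) atTop (𝓝 1) :=
  tendsto_cutoffProfile _

lemma le_log_norm_sq {c x : Plane} {a : ℝ} (h : Real.exp (a / 2) ≤ ‖x - c‖) :
    a ≤ Real.log (‖x - c‖ ^ 2) := by
  have := Real.log_le_log (Real.exp_pos _) h
  rw [Real.log_exp] at this
  rw [Real.log_pow]
  push_cast
  linarith

lemma hasCompactSupport_cutoff (c : Plane) {N : ℝ} (hN : 0 < N) :
    HasCompactSupport (cutoff c N) := by
  refine HasCompactSupport.intro (isCompact_closedBall c (Real.exp ((N + 1) / 2))) ?_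
  intro x hx
  rw [Metric.mem_closedBall, not_le, dist_eq_norm] at hx
  exact cutoffProfile_of_le hN (le_log_norm_sq hx.le)

lemma hasCompactSupport_annulusWeight (c : Plane) (a : ℝ) :
    HasCompactSupport (annulusWeight c a) := by
  refine HasCompactSupport.intro (isCompact_closedBall c (Real.exp ((a + 1) / 2))) ?_
  intro x hx
  rw [Metric.mem_closedBall, not_le, dist_eq_norm] at hx
  have := le_log_norm_sq hx.le
  rw [annulusWeight, rampBump_of_one_le (by linarith)]
  simp

lemma annulusWeight_nonneg (c : Plane) (a : ℝ) (x : Plane) : 0 ≤ annulusWeight c a x :=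
  div_nonneg (mul_nonneg (by norm_num) (rampBump_nonneg _)) (by positivity)

lemma annulusWeight_of_norm_le_one {c x : Plane} {a : ℝ} (ha : 0 ≤ a) (hx : ‖x - c‖ ≤ 1) :
    annulusWeight c a x = 0 := by
  have := log_sq_nonpos (norm_nonneg (x - c)) hx
  rw [annulusWeight, rampBump_of_nonpos (by linarith)]
  simp

lemma continuous_annulusWeight (c : Plane) {a : ℝ} (ha : 0 ≤ a) :
    Continuous (annulusWeight c a) := by
  rw [continuous_iff_continuousAt]
  intro x
  rcases eq_or_ne x c with rfl | hx
  · refine (continuousAt_const (y := (0 : ℝ))).congr ?_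
    filter_upwards [eventually_norm_sub_lt_one x] with y hy
    exact (annulusWeight_of_norm_le_one ha hy.le).symm
  · have h1 := (contDiffAt_log_norm_sub_sq hx).continuousAt
    have h2 : ContinuousAt (fun y : Plane => ‖y - c‖ ^ 2) x := by fun_prop
    refine ContinuousAt.div ?_ h2 (pow_ne_zero 2 (norm_ne_zero_iff.2 (sub_ne_zero.2 hx)))
    exact continuousAt_const.mul
      (continuous_rampBump.continuousAt.comp (h1.sub continuousAt_const))

/-- The constant is `4` times the bound `2` for `rampBump`; it does not depend on `a`, which makes
later estimates uniform in `N`. -/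
lemma annulusWeight_mul_le (c : Plane) (a : ℝ) (x : Plane) :
    annulusWeight c a x * ‖x - c‖ ^ 2 ≤ 8 := by
  rcases eq_or_ne (‖x - c‖ ^ 2) 0 with h | h
  · rw [h]; norm_num
  · rw [annulusWeight, div_mul_cancel₀ _ h]
    linarith [rampBump_le (Real.log (‖x - c‖ ^ 2) - a)]

/-! ### Laplacians of radial functions in the plane -/

lemma fderiv_norm_sub_sq (c x w : Plane) :
    fderiv ℝ (fun y : Plane => ‖y - c‖ ^ 2) x w = 2 * inner ℝ (x - c) w := by
  have h := ((hasFDerivAt_id x).sub_const c).norm_sq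
  rw [show (fun y : Plane => ‖y - c‖ ^ 2) = fun y => ‖id y - c‖ ^ 2 from rfl, h.fderiv]
  simp [inner_sub_left]

lemma laplacian_norm_sub_sq (c x : Plane) :
    Laplacian.laplacian (fun y : Plane => ‖y - c‖ ^ 2) x = 4 := by
  have h : fderiv ℝ (fun y : Plane => ‖y - c‖ ^ 2) =
      fun y => (2 : ℝ) • innerSL ℝ (y - c) := by
    ext y w
    simp [fderiv_norm_sub_sq, inner_sub_left]
  have h2 : HasFDerivAt (fun y : Plane => (2 : ℝ) • innerSL ℝ (y - c)) ((2 : ℝ) • innerSL ℝ) x :=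
    ((innerSL ℝ).hasFDerivAt.comp x ((hasFDerivAt_id x).sub_const c)).const_smul (2 : ℝ)
  have h3 : ∀ w : Plane, fderiv ℝ (fderiv ℝ (fun y : Plane => ‖y - c‖ ^ 2)) x w w =
      2 * ‖w‖ ^ 2 := by
    intro w
    rw [h, h2.fderiv, ← real_inner_self_eq_norm_sq]
    rfl
  rw [laplacian_eq_sum_fderiv (EuclideanSpace.basisFun (Fin 2) ℝ)]
  simp only [h3, OrthonormalBasis.norm_eq_one, Fin.sum_univ_two]
  norm_num

lemma sum_fderiv_norm_sub_sq (c x : Plane) :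
    ∑ i, (fderiv ℝ (fun y : Plane => ‖y - c‖ ^ 2) x (EuclideanSpace.basisFun (Fin 2) ℝ i)) ^ 2 =
      4 * ‖x - c‖ ^ 2 := by
  simp only [fderiv_norm_sub_sq, mul_pow, ← Finset.mul_sum]
  rw [(EuclideanSpace.basisFun (Fin 2) ℝ).sum_sq_inner_left]
  norm_num

/-- The Laplacian of a function of `log ‖x - c‖²`, a harmonic function of the plane. -/
lemma laplacian_comp_log_norm_sub_sq {c x : Plane} (hx : x ≠ c) {j j' : ℝ → ℝ} {j'' : ℝ}
    (hj : ∀ l, HasDerivAt j (j' l) l) (hj' : HasDerivAt j' j'' (Real.log (‖x - c‖ ^ 2))) :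
    Laplacian.laplacian (fun y : Plane => j (Real.log (‖y - c‖ ^ 2))) x =
      j'' * (4 / ‖x - c‖ ^ 2) := by
  have hs : ‖x - c‖ ^ 2 ≠ 0 := pow_ne_zero 2 (norm_ne_zero_iff.2 (sub_ne_zero.2 hx))
  have h1 : ContDiffAt ℝ 2 (fun y : Plane => ‖y - c‖ ^ 2) x :=
    ((contDiff_id.sub contDiff_const).norm_sq ℝ).contDiffAt
  have d1 : ∀ᶠ s in 𝓝 (‖x - c‖ ^ 2), HasDerivAt (fun s : ℝ => Real.log s) s⁻¹ s := by
    filter_upwards [isOpen_ne.mem_nhds hs] with s h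
    exact Real.hasDerivAt_log h
  -- With `s = ‖x - c‖²` the chain rule gives `s⁻¹ * 4 - s⁻² * 4 s = 0`; this is where dimension two
  -- enters.
  have hl : Laplacian.laplacian (fun y : Plane => Real.log (‖y - c‖ ^ 2)) x = 0 := by
    rw [laplacian_comp (EuclideanSpace.basisFun (Fin 2) ℝ) h1 d1 (hasDerivAt_inv hs),
      laplacian_norm_sub_sq, sum_fderiv_norm_sub_sq]
    field_simp
    ring
  rw [laplacian_comp (EuclideanSpace.basisFun (Fin 2) ℝ) (contDiffAt_log_norm_sub_sq hx)
    (Eventually.of_forall hj) hj', hl]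
  have hg : ∀ w, fderiv ℝ (fun y : Plane => Real.log (‖y - c‖ ^ 2)) x w =
      (‖x - c‖ ^ 2)⁻¹ * fderiv ℝ (fun y : Plane => ‖y - c‖ ^ 2) x w := by
    intro w
    have := ((Real.hasDerivAt_log hs).comp_hasFDerivAt x
      (h1.differentiableAt (by simp)).hasFDerivAt).fderiv
    simp only [Function.comp_def] at this
    rw [this]
    simp
  simp only [hg, mul_pow, ← Finset.mul_sum, sum_fderiv_norm_sub_sq]
  field_simp
  ring

/-- As `log ‖x - c‖²` is harmonic away from `c`, only the second derivative of the profile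
contributes. It is nonnegative on the outer annulus and nonpositive on the inner one. -/
lemma laplacian_cutoff (c : Plane) {N : ℝ} (hN : 0 < N) (x : Plane) :
    Laplacian.laplacian (cutoff c N) x = (annulusWeight c N x - annulusWeight c 0 x) / N := by
  rcases eq_or_ne x c with rfl | hx
  · have h : cutoff x N =ᶠ[𝓝 x] fun _ => (1 : ℝ) := by
      filter_upwards [eventually_norm_sub_lt_one x] with y hy
      exact cutoffProfile_of_nonpos hN.le (log_sq_nonpos (norm_nonneg _) hy.le)
    rw [(InnerProductSpace.laplacian_congr_nhds h).self_of_nhds,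
      InnerProductSpace.laplacian_const]
    simp [annulusWeight]
  · have := laplacian_comp_log_norm_sub_sq hx (hasDerivAt_cutoffProfile N)
      (hasDerivAt_deriv_cutoffProfile N _)
    rw [show cutoff c N = fun y => cutoffProfile N (Real.log (‖y - c‖ ^ 2)) from rfl, this,
      annulusWeight, annulusWeight, sub_zero]
    ring

/-- Morally `Δ log ‖x - c‖² = 4π δ_c` and the cutoff is `1` at `c`. The value is computed in polar
coordinates, which avoids the singularity since the integrand vanishes on the unit ball. -/
lemma integral_log_mul_laplacian_cutoff (c : Plane) {N : ℝ} (hN : 0 < N) :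
    ∫ x, Real.log (‖x - c‖ ^ 2) * Laplacian.laplacian (cutoff c N) x = 4 * Real.pi := by
  set k : ℝ → ℝ := fun l => (rampBump (l - N) - rampBump l) / N with hk
  set F : ℝ → ℝ := fun r => Real.log (r ^ 2) * (4 * k (Real.log (r ^ 2)) / r ^ 2) with hF
  have h1 : ∀ x : Plane, Real.log (‖x - c‖ ^ 2) * Laplacian.laplacian (cutoff c N) x =
      F ‖x - c‖ := by
    intro x
    rw [laplacian_cutoff c hN]
    simp only [hF, hk, annulusWeight, sub_zero]
    ring
  simp only [h1]
  rw [integral_sub_right_eq_self (fun x : Plane => F ‖x‖) c, integral_fun_norm_addHaar]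
  have hvol : (volume : Measure Plane).real (Metric.ball 0 1) = Real.pi := by
    rw [Measure.real, EuclideanSpace.volume_ball_fin_two]
    simp [Real.pi_pos.le]
  set Y := Real.exp ((N + 1) / 2) with hY
  have hY1 : 1 ≤ Y := Real.one_le_exp (by linarith)
  have h2 : ∫ y in Ioi (0 : ℝ), y ^ (Module.finrank ℝ Plane - 1) • F y =
      ∫ y in (1 : ℝ)..Y, y * F y := by
    rw [intervalIntegral.integral_of_le hY1]
    simp only [finrank_euclideanSpace_fin, Nat.add_one_sub_one, pow_one, smul_eq_mul]
    refine setIntegral_eq_of_subset_of_forall_sdiff_eq_zero measurableSet_Ioi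
      (fun y (hy : y ∈ Ioc 1 Y) => zero_lt_one.trans hy.1) fun y hy => ?_
    have hy0 : (0 : ℝ) < y := hy.1
    have hk0 : k (Real.log (y ^ 2)) = 0 := by
      rcases le_or_gt y 1 with h | h
      · have := log_sq_nonpos hy0.le h
        simp only [hk]
        rw [rampBump_of_nonpos this, rampBump_of_nonpos (by linarith)]
        simp
      · have hyY : Y < y := by
          by_contra hcon
          exact hy.2 ⟨h, not_lt.1 hcon⟩
        have := Real.log_le_log (Real.exp_pos _) hyY.le
        rw [Real.log_exp] at this
        have h3 : N + 1 ≤ Real.log (y ^ 2) := by rw [Real.log_pow]; push_cast; linarith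
        simp only [hk]
        rw [rampBump_of_one_le (by linarith), rampBump_of_one_le (by linarith)]
        simp
    simp only [hF, hk0]
    simp
  set q : ℝ → ℝ := fun l => -((rampSlope l - rampSlope (l - N)) / N) with hq
  -- In the variable `l = log y²` this is integration by parts: `l η' - η` is a primitive of `l
  -- η''`, where `η` is the profile.
  have hder : ∀ y ∈ uIcc 1 Y, HasDerivAt
      (fun y : ℝ => 2 * (q (Real.log (y ^ 2)) * Real.log (y ^ 2) -
        cutoffProfile N (Real.log (y ^ 2)))) (y * F y) y := by
    intro y hy
    rw [uIcc_of_le hY1] at hy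
    have hy0 : y ≠ 0 := by linarith [hy.1]
    have hl : HasDerivAt (fun y : ℝ => Real.log (y ^ 2)) (2 / y) y := by
      refine ((hasDerivAt_pow 2 y).log (pow_ne_zero 2 hy0)).congr_deriv ?_
      field_simp
      norm_num [mul_comm]
    have hq' := (hasDerivAt_deriv_cutoffProfile N (Real.log (y ^ 2))).comp y hl
    have hη := (hasDerivAt_cutoffProfile N (Real.log (y ^ 2))).comp y hl
    refine (((hq'.mul hl).sub hη).const_mul 2).congr_deriv ?_
    simp only [hF, hk, Function.comp_def]
    field_simp
    ring
  have hcont : ContinuousOn (fun y => y * F y) (uIcc 1 Y) := by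
    intro y hy
    rw [uIcc_of_le hY1] at hy
    have hy0 : y ^ 2 ≠ 0 := pow_ne_zero 2 (by linarith [hy.1])
    have hl : ContinuousAt (fun y : ℝ => Real.log (y ^ 2)) y :=
      (continuousAt_id.pow 2).log hy0
    have hb := continuous_rampBump
    have hkc : Continuous k := by simp only [hk]; fun_prop
    exact (continuousAt_id.mul (hl.mul ((continuousAt_const.mul
      (hkc.continuousAt.comp hl)).div (continuousAt_id.pow 2) hy0))).continuousWithinAt
  rw [h2, intervalIntegral.integral_eq_sub_of_hasDerivAt hder hcont.intervalIntegrable, hvol]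
  have hlY : Real.log (Y ^ 2) = N + 1 := by
    rw [Real.log_pow, hY, Real.log_exp]; push_cast; ring
  rw [hlY, cutoffProfile_of_le hN le_rfl]
  simp only [one_pow, Real.log_one, hq]
  rw [cutoffProfile_of_nonpos hN.le le_rfl, rampSlope_of_one_le (by linarith),
    rampSlope_of_one_le (by linarith)]
  simp
  ring

/-! ### Approximation of the positive part -/

/-- The indicator function of the positive half line. -/
noncomputable def step (a : ℝ) : ℝ := if 0 < a then 1 else 0

lemma measurable_step : Measurable step :=
  Measurable.ite measurableSet_Ioi measurable_const measurable_const

lemma abs_step_le (a : ℝ) : |step a| ≤ 1 := by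
  unfold step; split_ifs <;> simp

/-- The function of `ε` is eventually constant: the slope is `0` for `a ≤ ε` and `1` for `a ≥ 2 ε`.
-/
lemma tendsto_rampSlope_step (a : ℝ) :
    Tendsto (fun ε : ℝ => rampSlope (a / ε - 1)) (𝓝[>] 0) (𝓝 (step a)) := by
  refine tendsto_const_nhds.congr' ?_
  by_cases ha : 0 < a
  · filter_upwards [Ioo_mem_nhdsGT (half_pos ha)] with ε hε
    have : 2 ≤ a / ε := (le_div_iff₀ hε.1).2 (by linarith [hε.2])
    rw [rampSlope_of_one_le (by linarith), step, if_pos ha]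
  · filter_upwards [self_mem_nhdsWithin] with ε hε
    have : a / ε ≤ 0 := div_nonpos_of_nonpos_of_nonneg (not_lt.1 ha) (le_of_lt hε)
    rw [rampSlope_of_nonpos (by linarith), step, if_neg ha]

lemma mul_ramp_nonneg {ε : ℝ} (hε : 0 < ε) (a : ℝ) : 0 ≤ ε * ramp (a / ε - 1) :=
  mul_nonneg hε.le (ramp_nonneg _)

lemma mul_ramp_le_max {ε : ℝ} (hε : 0 < ε) (a : ℝ) : ε * ramp (a / ε - 1) ≤ max a 0 := by
  have h : ramp (a / ε - 1) ≤ max (a / ε) 0 :=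
    (ramp_le_max _).trans (max_le_max (by linarith) le_rfl)
  calc ε * ramp (a / ε - 1) ≤ ε * max (a / ε) 0 := mul_le_mul_of_nonneg_left h hε.le
    _ = max a 0 := by rw [mul_max_of_nonneg _ _ hε.le, mul_div_cancel₀ _ hε.ne', mul_zero]

lemma tendsto_mul_ramp_max (a : ℝ) :
    Tendsto (fun ε : ℝ => ε * ramp (a / ε - 1)) (𝓝[>] 0) (𝓝 (max a 0)) := by
  by_cases ha : 0 < a
  · have h : Tendsto (fun ε : ℝ => a + ε * (ramp 1 - 2)) (𝓝[>] 0) (𝓝 (a + 0 * (ramp 1 - 2))) :=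
      ((continuous_const.add (continuous_id.mul continuous_const)).tendsto _).mono_left
        nhdsWithin_le_nhds
    rw [max_eq_left ha.le]
    rw [zero_mul, add_zero] at h
    refine h.congr' ?_
    filter_upwards [Ioo_mem_nhdsGT (half_pos ha)] with ε hε
    have : 2 ≤ a / ε := (le_div_iff₀ hε.1).2 (by linarith [hε.2])
    rw [ramp_of_one_le (x := a / ε - 1) (by linarith)]
    have := hε.1.ne'
    field_simp
    ring
  · rw [max_eq_right (not_lt.1 ha)]
    refine tendsto_const_nhds.congr' ?_
    filter_upwards [self_mem_nhdsWithin] with ε hε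
    have : a / ε ≤ 0 := div_nonpos_of_nonpos_of_nonneg (not_lt.1 ha) (le_of_lt hε)
    rw [ramp_of_nonpos (by linarith), mul_zero]

lemma hasDerivAt_mul_ramp {ε : ℝ} (hε : ε ≠ 0) (a : ℝ) :
    HasDerivAt (fun a : ℝ => ε * ramp (a / ε - 1)) (rampSlope (a / ε - 1)) a := by
  have h := ((hasDerivAt_ramp (a / ε - 1)).comp a
    (((hasDerivAt_id a).div_const ε).sub_const 1)).const_mul ε
  refine h.congr_deriv ?_
  field_simp

lemma hasDerivAt_rampSlope_div {ε : ℝ} (a : ℝ) :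
    HasDerivAt (fun a : ℝ => rampSlope (a / ε - 1)) (rampBump (a / ε - 1) / ε) a := by
  have h := (hasDerivAt_rampSlope (a / ε - 1)).comp a
    (((hasDerivAt_id a).div_const ε).sub_const 1)
  refine h.congr_deriv ?_
  ring

/-- The fundamental theorem of calculus for the positive part of a `C¹` function. -/
lemma integral_step_mul_deriv {w w' : ℝ → ℝ} {τ t : ℝ} (hτ : τ ≤ t)
    (hw : ∀ s ∈ Icc τ t, HasDerivAt w (w' s) s) (hw' : ContinuousOn w' (Icc τ t)) :
    ∫ s in Ioc τ t, step (w s) * w' s = max (w t) 0 - max (w τ) 0 := by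
  rw [← intervalIntegral.integral_of_le hτ]
  have hwc : ContinuousOn w (Icc τ t) := fun s hs => (hw s hs).continuousAt.continuousWithinAt
  have hcont : ∀ ε : ℝ, ContinuousOn (fun s => rampSlope (w s / ε - 1) * w' s) (Icc τ t) :=
    fun ε => (continuous_rampSlope.comp_continuousOn
      ((hwc.div_const ε).sub continuousOn_const)).mul hw'
  -- The chain rule is exact for the regularized positive part; both sides then pass to the limit,
  -- the integral by domination with `|w'|`.
  have hlim : Tendsto (fun ε : ℝ => ∫ s in τ..t, rampSlope (w s / ε - 1) * w' s) (𝓝[>] 0)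
      (𝓝 (∫ s in τ..t, step (w s) * w' s)) := by
    refine intervalIntegral.tendsto_integral_filter_of_dominated_convergence (fun s => |w' s|)
      (Eventually.of_forall fun ε => ?_) (Eventually.of_forall fun ε => ?_) ?_ ?_
    · rw [uIoc_of_le hτ]
      exact ((hcont ε).mono Ioc_subset_Icc_self).aestronglyMeasurable measurableSet_Ioc
    · refine Eventually.of_forall fun s _ => ?_
      rw [Real.norm_eq_abs, abs_mul, abs_of_nonneg (rampSlope_nonneg _)]
      exact mul_le_of_le_one_left (abs_nonneg _) (rampSlope_le_one _)
    · exact ContinuousOn.intervalIntegrable (by rw [uIcc_of_le hτ]; exact hw'.abs)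
    · exact Eventually.of_forall fun s _ => (tendsto_rampSlope_step _).mul_const _
  refine tendsto_nhds_unique hlim ?_
  refine ((tendsto_mul_ramp_max (w t)).sub (tendsto_mul_ramp_max (w τ))).congr' ?_
  filter_upwards [self_mem_nhdsWithin] with ε hε
  symm
  refine intervalIntegral.integral_eq_sub_of_hasDerivAt
    (f := fun s => ε * ramp (w s / ε - 1)) (fun s hs => ?_)
    (ContinuousOn.intervalIntegrable (by rw [uIcc_of_le hτ]; exact hcont ε))
  rw [uIcc_of_le hτ] at hs
  exact (hasDerivAt_mul_ramp (ne_of_gt hε) (w s)).comp s (hw s hs)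

/-! ### Kato's inequality -/

/-- Kato's inequality, in regularized form, on an open set on whose boundary `h ≤ 0`. -/
lemma integral_rampSlope_mul_laplacian_le {H : Set Plane} (hH : IsOpen H) {h φ : Plane → ℝ}
    (hh : ContDiff ℝ 2 h) (hfr : ∀ x ∈ frontier H, h x ≤ 0) (hφ : ContDiff ℝ 2 φ)
    (hc : HasCompactSupport φ) (hφ0 : ∀ x, 0 ≤ φ x) {ε : ℝ} (hε : 0 < ε) :
    ∫ x in H, rampSlope (h x / ε - 1) * Laplacian.laplacian h x * φ x ≤
      ∫ x in H, ε * ramp (h x / ε - 1) * Laplacian.laplacian φ x := by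
  set j : ℝ → ℝ := fun a => ε * ramp (a / ε - 1) with hj
  set F : Plane → ℝ := H.indicator fun x => j (h x) with hF
  have hjC : ContDiff ℝ 2 j :=
    contDiff_const.mul (contDiff_ramp.comp ((contDiff_id.div_const ε).sub contDiff_const))
  have hin : ∀ x ∈ H, F =ᶠ[𝓝 x] fun x => j (h x) := fun x hx => by
    filter_upwards [hH.mem_nhds hx] with y hy
    exact indicator_of_mem hy _
  -- The shift by `-1` pays off here: near a boundary point `h < ε`, where the regularization
  -- already vanishes, so the extension by zero is `C²` across the frontier.
  have hout : ∀ x ∉ H, F =ᶠ[𝓝 x] fun _ => 0 := fun x hx => by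
    by_cases hxc : x ∈ closure H
    · have hxf : h x < ε := (hfr x (by rw [hH.frontier_eq]; exact ⟨hxc, hx⟩)).trans_lt hε
      filter_upwards [hh.continuous.continuousAt.eventually (gt_mem_nhds hxf)] with y hy
      have : h y / ε ≤ 1 := (div_le_one hε).2 (le_of_lt hy)
      simp only [hF, indicator, hj]
      rw [ramp_of_nonpos (by linarith), mul_zero, ite_self]
    · filter_upwards [isClosed_closure.isOpen_compl.mem_nhds hxc] with y hy
      exact indicator_of_notMem (fun h' => hy (subset_closure h')) _
  have hFC : ContDiff ℝ 2 F := contDiff_iff_contDiffAt.2 fun x => by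
    by_cases hx : x ∈ H
    · exact (hjC.comp hh).contDiffAt.congr_of_eventuallyEq (hin x hx)
    · exact contDiffAt_const.congr_of_eventuallyEq (hout x hx)
  have hg := integral_mul_laplacian_comm hFC hφ hc
  have hl : ∫ x in H, j (h x) * Laplacian.laplacian φ x =
      ∫ x, F x * Laplacian.laplacian φ x := by
    rw [← integral_indicator hH.measurableSet]
    refine integral_congr_ae (Eventually.of_forall fun x => ?_)
    by_cases hx : x ∈ H <;> simp [hF, hx]
  rw [hl, hg, ← integral_indicator hH.measurableSet]
  have hcont : Continuous fun x => rampSlope (h x / ε - 1) * Laplacian.laplacian h x * φ x := by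
    have h1 := continuous_rampSlope
    have h2 := hh.continuous
    have h3 := continuous_laplacian hh
    have h4 := hφ.continuous
    fun_prop
  refine integral_mono ((hcont.integrable_of_hasCompactSupport hc.mul_left).indicator
    hH.measurableSet) (((continuous_laplacian hFC).mul hφ.continuous).integrable_of_hasCompactSupport
      hc.mul_left) fun x => ?_
  by_cases hx : x ∈ H
  · simp only [indicator_of_mem hx]
    refine mul_le_mul_of_nonneg_right ?_ (hφ0 x)
    rw [(InnerProductSpace.laplacian_congr_nhds (hin x hx)).self_of_nhds,
      laplacian_comp (stdOrthonormalBasis ℝ Plane) hh.contDiffAt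
        (Eventually.of_forall (hasDerivAt_mul_ramp hε.ne')) (hasDerivAt_rampSlope_div _)]
    -- The discarded term is `j''(h) |∇h|²`, nonnegative by convexity of `j`.
    refine le_add_of_nonneg_right (mul_nonneg (div_nonneg (rampBump_nonneg _) hε.le) ?_)
    exact Finset.sum_nonneg fun i _ => sq_nonneg _
  · simp only [indicator_of_notMem hx]
    rw [(InnerProductSpace.laplacian_congr_nhds (hout x hx)).self_of_nhds,
      InnerProductSpace.laplacian_const]
    simp

/-- Kato's inequality on an open set on whose boundary `h ≤ 0`. -/
lemma integral_step_mul_laplacian_le {H : Set Plane} (hH : IsOpen H) {h φ : Plane → ℝ}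
    (hh : ContDiff ℝ 2 h) (hfr : ∀ x ∈ frontier H, h x ≤ 0) (hφ : ContDiff ℝ 2 φ)
    (hc : HasCompactSupport φ) (hφ0 : ∀ x, 0 ≤ φ x) :
    ∫ x in H, step (h x) * Laplacian.laplacian h x * φ x ≤
      ∫ x in H, max (h x) 0 * Laplacian.laplacian φ x := by
  have c1 := hh.continuous
  have c2 := continuous_laplacian hh
  have c3 := hφ.continuous
  have c4 := continuous_laplacian hφ
  have cr := continuous_ramp
  have cs := continuous_rampSlope
  have hc' : HasCompactSupport (Laplacian.laplacian φ) :=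
    hc.mono' fun x hx => not_imp_comm.1 laplacian_of_notMem_tsupport hx
  have l1 : Tendsto (fun ε : ℝ => ∫ x in H, rampSlope (h x / ε - 1) *
      Laplacian.laplacian h x * φ x) (𝓝[>] 0)
      (𝓝 (∫ x in H, step (h x) * Laplacian.laplacian h x * φ x)) := by
    refine tendsto_integral_filter_of_dominated_convergence
      (fun x => |Laplacian.laplacian h x * φ x|) (Eventually.of_forall fun ε => ?_)
      (Eventually.of_forall fun ε => Eventually.of_forall fun x => ?_) ?_ ?_
    · exact Continuous.aestronglyMeasurable (by fun_prop)
    · rw [Real.norm_eq_abs, mul_assoc, abs_mul, abs_of_nonneg (rampSlope_nonneg _)]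
      exact mul_le_of_le_one_left (abs_nonneg _) (rampSlope_le_one _)
    · exact ((c2.mul c3).integrable_of_hasCompactSupport hc.mul_left).abs.integrableOn
    · exact Eventually.of_forall fun x => ((tendsto_rampSlope_step _).mul_const _).mul_const _
  have l2 : Tendsto (fun ε : ℝ => ∫ x in H, ε * ramp (h x / ε - 1) *
      Laplacian.laplacian φ x) (𝓝[>] 0)
      (𝓝 (∫ x in H, max (h x) 0 * Laplacian.laplacian φ x)) := by
    refine tendsto_integral_filter_of_dominated_convergence
      (fun x => |max (h x) 0 * Laplacian.laplacian φ x|) (Eventually.of_forall fun ε => ?_)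
      ?_ ?_ ?_
    · exact Continuous.aestronglyMeasurable (by fun_prop)
    · filter_upwards [self_mem_nhdsWithin] with ε hε
      refine Eventually.of_forall fun x => ?_
      rw [Real.norm_eq_abs, abs_mul, abs_mul (max _ _), abs_of_nonneg (mul_ramp_nonneg hε _)]
      exact mul_le_mul_of_nonneg_right ((mul_ramp_le_max hε _).trans (le_abs_self _)) (abs_nonneg _)
    · exact ((Continuous.mul (by fun_prop) c4).integrable_of_hasCompactSupport
        hc'.mul_left).abs.integrableOn
    · exact Eventually.of_forall fun x => (tendsto_mul_ramp_max _).mul_const _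
  refine le_of_tendsto_of_tendsto l1 l2 ?_
  filter_upwards [self_mem_nhdsWithin] with ε hε
  exact integral_rampSlope_mul_laplacian_le hH hh hfr hφ hc hφ0 hε

/-! ### Integration over space-time strips -/

/-- Lebesgue measure on the strip `ℝ² × (τ, t]`. -/
noncomputable def stripMeasure (τ t : ℝ) : Measure (Plane × ℝ) :=
  (volume : Measure Plane).prod (volume.restrict (Ioc τ t))

lemma stripMeasure_eq (τ t : ℝ) : stripMeasure τ t =
    ((volume : Measure Plane).prod volume).restrict (univ ×ˢ Ioc τ t) := by
  rw [stripMeasure, ← Measure.prod_restrict, Measure.restrict_univ]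

lemma aestronglyMeasurable_strip {F : Plane × ℝ → ℝ} {τ t : ℝ}
    (hF : ContinuousOn F (univ ×ˢ Icc τ t)) : AEStronglyMeasurable F (stripMeasure τ t) := by
  rw [stripMeasure_eq]
  exact (hF.mono (prod_mono_right Ioc_subset_Icc_self)).aestronglyMeasurable
    (MeasurableSet.univ.prod measurableSet_Ioc)

lemma integrable_strip {F : Plane × ℝ → ℝ} {τ t : ℝ} {K : Set Plane} (hK : IsCompact K)
    (hF : ContinuousOn F (univ ×ˢ Icc τ t)) (h0 : ∀ x ∉ K, ∀ s, F (x, s) = 0) :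
    Integrable F (stripMeasure τ t) := by
  have h1 : IntegrableOn F (K ×ˢ Icc τ t) ((volume : Measure Plane).prod volume) :=
    (hF.mono (prod_mono_left (subset_univ K))).integrableOn_compact (hK.prod isCompact_Icc)
  rw [stripMeasure_eq]
  refine IntegrableOn.of_forall_sdiff_eq_zero (h1.mono_set (prod_mono_right Ioc_subset_Icc_self))
    (MeasurableSet.univ.prod measurableSet_Ioc) fun p hp => ?_
  refine h0 p.1 (fun hk => hp.2 ⟨hk, hp.1.2⟩) p.2

/-! ### Solutions -/

/-- The part of the definition of a classical solution that is used below. -/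
structure IsRegularSolution (u : Plane → ℝ → ℝ) (T : ℝ) : Prop where
  pos : ∀ x : Plane, ∀ t ∈ Ioo (0 : ℝ) T, 0 < u x t
  contDiff_space : ∀ t ∈ Ioo (0 : ℝ) T, ContDiff ℝ 2 (fun x : Plane => u x t)
  differentiableAt_time : ∀ x : Plane, ∀ t ∈ Ioo (0 : ℝ) T, DifferentiableAt ℝ (fun s => u x s) t
  continuousOn : ContinuousOn (fun p : Plane × ℝ => u p.1 p.2) (univ ×ˢ Ioo (0 : ℝ) T)
  continuousOn_deriv :
    ContinuousOn (fun p : Plane × ℝ => deriv (fun s => u p.1 s) p.2) (univ ×ˢ Ioo (0 : ℝ) T)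
  equation : ∀ x : Plane, ∀ t ∈ Ioo (0 : ℝ) T,
    deriv (fun s => u x s) t = Laplacian.laplacian (fun y : Plane => Real.log (u y t)) x

lemma IsClassicalSolution.isRegularSolution {u : Plane → ℝ → ℝ} {T : ℝ}
    (hu : IsClassicalSolution u T) : IsRegularSolution u T :=
  ⟨hu.pos, hu.contDiff_space, hu.differentiableAt_time, hu.continuousOn, hu.continuousOn_deriv,
    hu.equation⟩

/-- The equation is invariant under isometries of the plane. -/
lemma IsRegularSolution.comp_isometry {u : Plane → ℝ → ℝ} {T : ℝ} (hu : IsRegularSolution u T)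
    (ρ : Plane ≃ₗᵢ[ℝ] Plane) (c : Plane) :
    IsRegularSolution (fun x t => u (ρ (x - c) + c) t) T := by
  have hρ : ContDiff ℝ 2 fun x : Plane => ρ (x - c) + c :=
    (ρ.contDiff.comp (contDiff_id.sub contDiff_const)).add contDiff_const
  have hm : Continuous fun p : Plane × ℝ => (ρ (p.1 - c) + c, p.2) := by fun_prop
  have hmaps : MapsTo (fun p : Plane × ℝ => (ρ (p.1 - c) + c, p.2)) (univ ×ˢ Ioo (0 : ℝ) T)
      (univ ×ˢ Ioo (0 : ℝ) T) := fun p hp => ⟨mem_univ _, hp.2⟩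
  refine ⟨fun x t ht => hu.pos _ t ht, fun t ht => (hu.contDiff_space t ht).comp hρ,
    fun x t ht => hu.differentiableAt_time _ t ht, hu.continuousOn.comp hm.continuousOn hmaps,
    hu.continuousOn_deriv.comp hm.continuousOn hmaps, fun x t ht => ?_⟩
  rw [hu.equation _ t ht]
  exact (laplacian_comp_affine ρ c c (fun y => Real.log (u y t)) x).symm

section

variable {u v : Plane → ℝ → ℝ} {T τ t : ℝ}

lemma IsRegularSolution.contDiff_log (hu : IsRegularSolution u T) {s : ℝ} (hs : s ∈ Ioo 0 T) :
    ContDiff ℝ 2 fun x => Real.log (u x s) :=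
  (hu.contDiff_space s hs).log fun x => (hu.pos x s hs).ne'

lemma IsRegularSolution.continuousOn_log (hu : IsRegularSolution u T) :
    ContinuousOn (fun p : Plane × ℝ => Real.log (u p.1 p.2)) (univ ×ˢ Ioo (0 : ℝ) T) :=
  hu.continuousOn.log fun p hp => (hu.pos p.1 p.2 hp.2).ne'

lemma strip_subset (hτ : 0 < τ) (ht : t < T) :
    (univ : Set Plane) ×ˢ Icc τ t ⊆ univ ×ˢ Ioo 0 T :=
  prod_mono_right fun _ hs => ⟨hτ.trans_le hs.1, hs.2.trans_lt ht⟩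

lemma IsRegularSolution.continuousOn_deriv_time (hu : IsRegularSolution u T) (hτ : 0 < τ)
    (ht : t < T) (x : Plane) : ContinuousOn (fun s => deriv (fun s => u x s) s) (Icc τ t) :=
  hu.continuousOn_deriv.comp (f := fun s : ℝ => (x, s)) (by fun_prop)
    fun _ hs => strip_subset hτ ht ⟨mem_univ x, hs⟩

/-- The weak form of the equation. -/
lemma IsRegularSolution.integral_mul_cutoff_sub (hu : IsRegularSolution u T) (hτ : 0 < τ)
    (hτt : τ ≤ t) (ht : t < T) {φ : Plane → ℝ} (hφ : ContDiff ℝ 2 φ) (hc : HasCompactSupport φ) :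
    ∫ x, u x t * φ x - u x τ * φ x =
      ∫ p, Real.log (u p.1 p.2) * Laplacian.laplacian φ p.1 ∂(stripMeasure τ t) := by
  have hsub := strip_subset (T := T) hτ ht
  have hK : ∀ x ∉ tsupport φ, φ x = 0 := fun x hx => image_eq_zero_of_notMem_tsupport hx
  have hK' := fun x hx => laplacian_of_notMem_tsupport (f := φ) (x := x) hx
  have cφ := hφ.continuous
  have cΔ := continuous_laplacian hφ
  have i1 : Integrable (fun p : Plane × ℝ => deriv (fun s => u p.1 s) p.2 * φ p.1)
      (stripMeasure τ t) :=
    integrable_strip hc ((hu.continuousOn_deriv.mono hsub).mul (by fun_prop))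
      fun x hx s => by simp [hK x hx]
  have i2 : Integrable (fun p : Plane × ℝ => Real.log (u p.1 p.2) * Laplacian.laplacian φ p.1)
      (stripMeasure τ t) :=
    integrable_strip hc ((hu.continuousOn_log.mono hsub).mul (by fun_prop))
      fun x hx s => by simp [hK' x hx]
  have e1 : ∫ p, deriv (fun s => u p.1 s) p.2 * φ p.1 ∂(stripMeasure τ t) =
      ∫ x, u x t * φ x - u x τ * φ x := by
    rw [stripMeasure, integral_prod _ i1]
    refine integral_congr_ae (Eventually.of_forall fun x => ?_)
    simp only
    rw [integral_mul_const, ← intervalIntegral.integral_of_le hτt,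
      intervalIntegral.integral_eq_sub_of_hasDerivAt (f := fun s => u x s)]
    · ring
    · intro s hs
      rw [uIcc_of_le hτt] at hs
      exact (hu.differentiableAt_time x s ⟨hτ.trans_le hs.1, hs.2.trans_lt ht⟩).hasDerivAt
    · refine ContinuousOn.intervalIntegrable ?_
      rw [uIcc_of_le hτt]
      exact hu.continuousOn_deriv_time hτ ht x
  rw [← e1, stripMeasure, integral_prod_symm _ i1, integral_prod_symm _ i2]
  refine setIntegral_congr_fun measurableSet_Ioc fun s hs => ?_
  have hs' : s ∈ Ioo 0 T := ⟨hτ.trans hs.1, hs.2.trans_lt ht⟩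
  simp only
  rw [integral_mul_laplacian_comm (hu.contDiff_log hs') hφ hc]
  refine integral_congr_ae (Eventually.of_forall fun x => ?_)
  simp only
  rw [hu.equation x s hs']

/-- The growth of `∫_H (v - u)₊ φ` for two solutions with `v ≤ u` on the boundary of `H`. -/
lemma IsRegularSolution.integral_posPart_le (hu : IsRegularSolution u T)
    (hv : IsRegularSolution v T) (hτ : 0 < τ) (hτt : τ ≤ t) (ht : t < T) {H : Set Plane}
    (hH : IsOpen H) (hfr : ∀ x ∈ frontier H, ∀ s ∈ Ioo 0 T, v x s ≤ u x s) {φ : Plane → ℝ}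
    (hφ : ContDiff ℝ 2 φ) (hc : HasCompactSupport φ) (hφ0 : ∀ x, 0 ≤ φ x) :
    ∫ x in H, (max (v x t - u x t) 0 * φ x - max (v x τ - u x τ) 0 * φ x) ≤
      ∫ p, H.indicator (fun x => max (Real.log (v x p.2) - Real.log (u x p.2)) 0 *
        Laplacian.laplacian φ x) p.1 ∂(stripMeasure τ t) := by
  have hsub := strip_subset (T := T) hτ ht
  have hK : ∀ x ∉ tsupport φ, φ x = 0 := fun x hx => image_eq_zero_of_notMem_tsupport hx
  have hK' := fun x hx => laplacian_of_notMem_tsupport (f := φ) (x := x) hx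
  have cφ := hφ.continuous
  have cΔ := continuous_laplacian hφ
  have hHm : MeasurableSet (H ×ˢ (univ : Set ℝ)) := hH.measurableSet.prod MeasurableSet.univ
  set w : Plane × ℝ → ℝ := fun p => v p.1 p.2 - u p.1 p.2 with hw
  set w' : Plane × ℝ → ℝ := fun p => deriv (fun s => v p.1 s) p.2 - deriv (fun s => u p.1 s) p.2
    with hw'
  have cw : ContinuousOn w (univ ×ˢ Icc τ t) :=
    (hv.continuousOn.mono hsub).sub (hu.continuousOn.mono hsub)
  have cw' : ContinuousOn w' (univ ×ˢ Icc τ t) :=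
    (hv.continuousOn_deriv.mono hsub).sub (hu.continuousOn_deriv.mono hsub)
  have i0 : Integrable (fun p => w' p * φ p.1) (stripMeasure τ t) :=
    integrable_strip hc (cw'.mul (by fun_prop)) fun x hx s => by simp [hK x hx]
  have i1 : Integrable (fun p => (H ×ˢ (univ : Set ℝ)).indicator
      (fun p => step (w p) * (w' p * φ p.1)) p) (stripMeasure τ t) := by
    refine Integrable.indicator (i0.mono ?_ (Eventually.of_forall fun p => ?_)) hHm
    · exact (measurable_step.comp_aemeasurable
        (aestronglyMeasurable_strip cw).aemeasurable).aestronglyMeasurable.mul i0.1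
    · rw [norm_mul, Real.norm_eq_abs]
      exact mul_le_of_le_one_left (norm_nonneg _) (abs_step_le _)
  have i2 : Integrable (fun p => (H ×ˢ (univ : Set ℝ)).indicator
      (fun p => max (Real.log (v p.1 p.2) - Real.log (u p.1 p.2)) 0 *
        Laplacian.laplacian φ p.1) p) (stripMeasure τ t) := by
    refine Integrable.indicator (integrable_strip hc (ContinuousOn.mul ?_ (by fun_prop))
      fun x hx s => by simp [hK' x hx]) hHm
    exact ((hv.continuousOn_log.mono hsub).sub (hu.continuousOn_log.mono hsub)).sup
      continuousOn_const
  have hind : ∀ (G : Plane × ℝ → ℝ) (x : Plane) (s : ℝ),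
      (H ×ˢ (univ : Set ℝ)).indicator G (x, s) = H.indicator (fun x => G (x, s)) x := by
    intro G x s
    by_cases hx : x ∈ H <;> simp [hx]
  have e2 : ∫ p, H.indicator (fun x => max (Real.log (v x p.2) - Real.log (u x p.2)) 0 *
        Laplacian.laplacian φ x) p.1 ∂(stripMeasure τ t) =
      ∫ p, (H ×ˢ (univ : Set ℝ)).indicator
      (fun p => max (Real.log (v p.1 p.2) - Real.log (u p.1 p.2)) 0 *
        Laplacian.laplacian φ p.1) p ∂(stripMeasure τ t) :=
    integral_congr_ae (Eventually.of_forall fun p => (hind (fun p =>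
      max (Real.log (v p.1 p.2) - Real.log (u p.1 p.2)) 0 * Laplacian.laplacian φ p.1) p.1 p.2).symm)
  have e1 : ∫ p, (H ×ˢ (univ : Set ℝ)).indicator (fun p => step (w p) * (w' p * φ p.1)) p
      ∂(stripMeasure τ t) =
      ∫ x in H, (max (v x t - u x t) 0 * φ x - max (v x τ - u x τ) 0 * φ x) := by
    rw [stripMeasure, integral_prod _ i1, ← integral_indicator hH.measurableSet]
    refine integral_congr_ae (Eventually.of_forall fun x => ?_)
    simp only [hind]
    by_cases hx : x ∈ H
    · simp only [indicator_of_mem hx, ← mul_assoc]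
      rw [integral_mul_const, integral_step_mul_deriv (w := fun s => w (x, s))
        (w' := fun s => w' (x, s)) hτt]
      · simp only [hw]
        ring
      · intro s hs
        have hs' : s ∈ Ioo 0 T := ⟨hτ.trans_le hs.1, hs.2.trans_lt ht⟩
        exact (hv.differentiableAt_time x s hs').hasDerivAt.sub
          (hu.differentiableAt_time x s hs').hasDerivAt
      · exact (hv.continuousOn_deriv_time hτ ht x).sub (hu.continuousOn_deriv_time hτ ht x)
    · simp [hx]
  rw [← e1, e2, stripMeasure, integral_prod_symm _ i1, integral_prod_symm _ i2]
  refine setIntegral_mono_on i1.integral_prod_right i2.integral_prod_right measurableSet_Ioc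
    fun s hs => ?_
  have hs' : s ∈ Ioo 0 T := ⟨hτ.trans hs.1, hs.2.trans_lt ht⟩
  simp only [hind]
  rw [integral_indicator hH.measurableSet, integral_indicator hH.measurableSet]
  have hlv := hv.contDiff_log hs'
  have hlu := hu.contDiff_log hs'
  refine le_trans (le_of_eq ?_) (integral_step_mul_laplacian_le hH (hlv.sub hlu)
    (fun x hx => sub_nonpos.2 (Real.log_le_log (hv.pos x s hs') (hfr x hx s hs'))) hφ hc hφ0)
  refine integral_congr_ae (Eventually.of_forall fun x => ?_)
  have hΔ : Laplacian.laplacian (fun x => Real.log (v x s) - Real.log (u x s)) x = w' (x, s) := by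
    have := hlv.contDiffAt.laplacian_sub (hlu.contDiffAt (x := x))
    rw [show (fun x => Real.log (v x s) - Real.log (u x s)) =
      (fun x => Real.log (v x s)) - fun x => Real.log (u x s) from rfl, this,
      ← hu.equation x s hs', ← hv.equation x s hs']
  -- Since the logarithm is increasing, `v - u` (differentiated in time) and `log v - log u` (to
  -- which Kato applies) have the same positivity set.
  have hst : step (w (x, s)) = step (Real.log (v x s) - Real.log (u x s)) := by
    simp only [step, hw, sub_pos, Real.log_lt_log_iff (hu.pos x s hs') (hv.pos x s hs')]
  simp only
  rw [hΔ, hst]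
  ring

end

/-! ### Consequences of the mass loss law -/

/-- The mass of `u` is finite and equal to `m - 4πt` at each time `t ∈ (0, T)`. -/
def HasLinearMassLoss (u : Plane → ℝ → ℝ) (m T : ℝ) : Prop :=
  ∀ t ∈ Ioo (0 : ℝ) T, Integrable (fun x : Plane => u x t) ∧
    ∫ x : Plane, u x t = m - 4 * Real.pi * t

lemma SatisfiesMassLoss.hasLinearMassLoss {u : Plane → ℝ → ℝ} {u₀ : Plane → ℝ} {T : ℝ}
    (h : SatisfiesMassLoss u u₀ (fun _ => 2) T) : HasLinearMassLoss u (∫ x, u₀ x) T := by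
  intro t ht
  refine ⟨(h t ht).1, ?_⟩
  rw [(h t ht).2, intervalIntegral.integral_const, smul_eq_mul]
  ring

lemma continuous_log_mul_annulusWeight (c : Plane) {a : ℝ} (ha : 0 ≤ a) :
    Continuous fun x => Real.log (‖x - c‖ ^ 2) * annulusWeight c a x := by
  rw [continuous_iff_continuousAt]
  intro x
  rcases eq_or_ne x c with rfl | hx
  · refine (continuousAt_const (y := (0 : ℝ))).congr ?_
    filter_upwards [eventually_norm_sub_lt_one x] with y hy
    rw [annulusWeight_of_norm_le_one ha hy.le, mul_zero]
  · exact (contDiffAt_log_norm_sub_sq hx).continuousAt.mul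
      (continuous_annulusWeight c ha).continuousAt

lemma tendsto_integral_mul_cutoff (c : Plane) {f : Plane → ℝ} {μ : Measure Plane}
    (hf : Integrable f μ) :
    Tendsto (fun N => ∫ x, f x * cutoff c N x ∂μ) atTop (𝓝 (∫ x, f x ∂μ)) := by
  refine tendsto_integral_filter_of_dominated_convergence (fun x => |f x|) ?_ ?_ hf.abs ?_
  · filter_upwards [eventually_gt_atTop 0] with N hN
    exact hf.1.mul (contDiff_cutoff c hN.le).continuous.aestronglyMeasurable
  · filter_upwards [eventually_gt_atTop 0] with N hN
    refine Eventually.of_forall fun x => ?_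
    rw [norm_mul, Real.norm_eq_abs, Real.norm_eq_abs, abs_of_nonneg (cutoff_nonneg c hN x)]
    exact mul_le_of_le_one_right (abs_nonneg _) (cutoff_le_one c hN x)
  · refine Eventually.of_forall fun x => ?_
    simpa using (tendsto_cutoff c x).const_mul (f x)

/-- `log (u(x,s) ‖x - c‖²)`. -/
noncomputable def logExcess (u : Plane → ℝ → ℝ) (c : Plane) (p : Plane × ℝ) : ℝ :=
  Real.log (u p.1 p.2) + Real.log (‖p.1 - c‖ ^ 2)

section

variable {u v : Plane → ℝ → ℝ} {T τ t m : ℝ}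

lemma IsRegularSolution.continuousOn_logExcess_mul (hu : IsRegularSolution u T) (hτ : 0 < τ)
    (ht : t < T) (c : Plane) {a : ℝ} (ha : 0 ≤ a) :
    ContinuousOn (fun p => logExcess u c p * annulusWeight c a p.1) (univ ×ˢ Icc τ t) := by
  have h1 := continuous_annulusWeight c ha
  have h2 := continuous_log_mul_annulusWeight c ha
  simp only [logExcess, add_mul]
  exact ((hu.continuousOn_log.mono (strip_subset hτ ht)).mul (by fun_prop)).add
    (h2.comp continuous_fst).continuousOn

lemma annulusWeight_of_notMem_tsupport {c x : Plane} {a : ℝ}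
    (hx : x ∉ tsupport (annulusWeight c a)) : annulusWeight c a x = 0 :=
  image_eq_zero_of_notMem_tsupport hx

lemma IsRegularSolution.integrable_logExcess_mul (hu : IsRegularSolution u T) (hτ : 0 < τ)
    (ht : t < T) (c : Plane) {a : ℝ} (ha : 0 ≤ a) :
    Integrable (fun p => logExcess u c p * annulusWeight c a p.1) (stripMeasure τ t) :=
  integrable_strip (hasCompactSupport_annulusWeight c a)
    (hu.continuousOn_logExcess_mul hτ ht c ha)
    fun x hx s => by simp only [annulusWeight_of_notMem_tsupport hx, mul_zero]

/-- The equation tested with the cutoff, after adding `log ‖x - c‖²` to `log u`; this addition costs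
`4π` per unit time. When mass is lost at exactly that rate, the right side tends to zero as `N → ∞`.
-/
lemma IsRegularSolution.integral_logExcess_mul (hu : IsRegularSolution u T) (hτ : 0 < τ)
    (hτt : τ ≤ t) (ht : t < T) (c : Plane) {N : ℝ} (hN : 0 < N) :
    (∫ p, logExcess u c p * annulusWeight c N p.1 ∂(stripMeasure τ t)) / N =
      (∫ x, u x t * cutoff c N x - u x τ * cutoff c N x) + 4 * Real.pi * (t - τ) +
      (∫ p, logExcess u c p * annulusWeight c 0 p.1 ∂(stripMeasure τ t)) / N := by
  have hφ := contDiff_cutoff c hN.le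
  have hc := hasCompactSupport_cutoff c hN
  have i1 := hu.integrable_logExcess_mul hτ ht c hN.le
  have i2 := hu.integrable_logExcess_mul hτ ht c le_rfl
  have hlog : Continuous fun x => Real.log (‖x - c‖ ^ 2) * Laplacian.laplacian (cutoff c N) x := by
    have h1 := continuous_log_mul_annulusWeight c hN.le
    have h2 := continuous_log_mul_annulusWeight c le_rfl
    have : (fun x => Real.log (‖x - c‖ ^ 2) * Laplacian.laplacian (cutoff c N) x) =
        fun x => (Real.log (‖x - c‖ ^ 2) * annulusWeight c N x -
          Real.log (‖x - c‖ ^ 2) * annulusWeight c 0 x) / N := by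
      ext x
      rw [laplacian_cutoff c hN]
      ring
    rw [this]
    exact (h1.sub h2).div_const N
  have cΔ := continuous_laplacian hφ
  have i3 : Integrable (fun p : Plane × ℝ =>
      Real.log (‖p.1 - c‖ ^ 2) * Laplacian.laplacian (cutoff c N) p.1) (stripMeasure τ t) :=
    integrable_strip (τ := τ) (t := t) hc (hlog.comp continuous_fst).continuousOn
      fun x hx s => by simp only [laplacian_of_notMem_tsupport hx, mul_zero]
  have i4 : Integrable (fun p : Plane × ℝ =>
      Real.log (u p.1 p.2) * Laplacian.laplacian (cutoff c N) p.1) (stripMeasure τ t) :=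
    integrable_strip (τ := τ) (t := t) hc
      ((hu.continuousOn_log.mono (strip_subset hτ ht)).mul (by fun_prop))
      fun x hx s => by simp only [laplacian_of_notMem_tsupport hx, mul_zero]
  have e3 : ∫ p, Real.log (‖p.1 - c‖ ^ 2) * Laplacian.laplacian (cutoff c N) p.1
      ∂(stripMeasure τ t) = 4 * Real.pi * (t - τ) := by
    rw [stripMeasure, integral_prod_symm _ i3]
    simp only [integral_log_mul_laplacian_cutoff c hN]
    rw [setIntegral_const, smul_eq_mul, Measure.real, Real.volume_Ioc,
      ENNReal.toReal_ofReal (by linarith)]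
    ring
  have e4 := hu.integral_mul_cutoff_sub hτ hτt ht hφ hc
  have e5 : (∫ p, logExcess u c p * annulusWeight c N p.1 ∂(stripMeasure τ t)) / N -
      (∫ p, logExcess u c p * annulusWeight c 0 p.1 ∂(stripMeasure τ t)) / N =
      ∫ p, (Real.log (u p.1 p.2) * Laplacian.laplacian (cutoff c N) p.1 +
        Real.log (‖p.1 - c‖ ^ 2) * Laplacian.laplacian (cutoff c N) p.1) ∂(stripMeasure τ t) := by
    rw [← sub_div, ← integral_sub i1 i2, ← integral_div]
    refine integral_congr_ae (Eventually.of_forall fun p => ?_)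
    simp only [laplacian_cutoff c hN, logExcess]
    ring
  rw [integral_add i4 i3, e3, ← e4] at e5
  linarith

/-- From `log s ≤ s - 1`, the positive part is at most `u ‖x - c‖²`, and the decay of the weight
absorbs `‖x - c‖²`. The finite mass of `u` thus controls the excess from above, uniformly in `a`. -/
lemma posPart_logExcess_mul_le {p : Plane × ℝ} (hp : 0 < u p.1 p.2) (c : Plane) (a : ℝ) :
    max (logExcess u c p) 0 * annulusWeight c a p.1 ≤ 8 * u p.1 p.2 := by
  -- At the centre the weight is `0` because division by zero yields zero.
  rcases eq_or_ne p.1 c with h | h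
  · simp [annulusWeight, h]
    simpa [h] using hp.le
  have hs : 0 < ‖p.1 - c‖ ^ 2 := by
    have := norm_pos_iff.2 (sub_ne_zero.2 h)
    positivity
  have h1 : max (logExcess u c p) 0 ≤ u p.1 p.2 * ‖p.1 - c‖ ^ 2 := by
    refine max_le ?_ (by positivity)
    rw [logExcess, ← Real.log_mul hp.ne' hs.ne']
    linarith [Real.log_le_sub_one_of_pos (mul_pos hp hs)]
  calc max (logExcess u c p) 0 * annulusWeight c a p.1
      ≤ u p.1 p.2 * ‖p.1 - c‖ ^ 2 * annulusWeight c a p.1 :=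
        mul_le_mul_of_nonneg_right h1 (annulusWeight_nonneg c a _)
    _ = u p.1 p.2 * (annulusWeight c a p.1 * ‖p.1 - c‖ ^ 2) := by ring
    _ ≤ u p.1 p.2 * 8 := mul_le_mul_of_nonneg_left (annulusWeight_mul_le c a _) hp.le
    _ = 8 * u p.1 p.2 := by ring

lemma max_mul_annulusWeight (c : Plane) (a r : ℝ) (x : Plane) :
    max (r * annulusWeight c a x) 0 = max r 0 * annulusWeight c a x := by
  rw [max_mul_of_nonneg _ _ (annulusWeight_nonneg c a x), zero_mul]

lemma IsRegularSolution.integrable_posPart_logExcess_mul (hu : IsRegularSolution u T)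
    (hτ : 0 < τ) (ht : t < T) (c : Plane) {a : ℝ} (ha : 0 ≤ a) :
    Integrable (fun p => max (logExcess u c p) 0 * annulusWeight c a p.1) (stripMeasure τ t) := by
  have := (hu.integrable_logExcess_mul hτ ht c ha).pos_part
  simpa only [max_mul_annulusWeight] using this

lemma IsRegularSolution.integral_posPart_logExcess_mul_le (hu : IsRegularSolution u T)
    (hm : HasLinearMassLoss u m T) (hτ : 0 < τ) (hτt : τ ≤ t) (ht : t < T) (c : Plane)
    {a : ℝ} (ha : 0 ≤ a) :
    ∫ p, max (logExcess u c p) 0 * annulusWeight c a p.1 ∂(stripMeasure τ t) ≤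
      8 * m * (t - τ) := by
  have i1 := hu.integrable_posPart_logExcess_mul hτ ht c ha
  rw [stripMeasure, integral_prod_symm _ i1]
  have hconst : ∫ _ in Ioc τ t, 8 * m = 8 * m * (t - τ) := by
    rw [setIntegral_const, smul_eq_mul, Measure.real, Real.volume_Ioc,
      ENNReal.toReal_ofReal (by linarith)]
    ring
  rw [← hconst]
  refine setIntegral_mono_on i1.integral_prod_right (integrableOn_const (by simp))
    measurableSet_Ioc fun s hs => ?_
  have hs' : s ∈ Ioo 0 T := ⟨hτ.trans hs.1, hs.2.trans_lt ht⟩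
  obtain ⟨hi, hI⟩ := hm s hs'
  calc ∫ x, max (logExcess u c (x, s)) 0 * annulusWeight c a x
      ≤ ∫ x, 8 * u x s := by
        refine integral_mono_of_nonneg (Eventually.of_forall fun x =>
          mul_nonneg (le_max_right _ _) (annulusWeight_nonneg c a x)) (hi.const_mul 8)
          (Eventually.of_forall fun x => posPart_logExcess_mul_le (p := (x, s))
            (hu.pos x s hs') c a)
    _ = 8 * (m - 4 * Real.pi * s) := by rw [integral_const_mul, hI]
    _ ≤ 8 * m := by nlinarith [Real.pi_pos, hs'.1]

/-- In the mean over large annuli, `log (u ‖x - c‖²)` is small compared with `log ‖x - c‖`. -/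
lemma IsRegularSolution.tendsto_integral_abs_logExcess (hu : IsRegularSolution u T)
    (hm : HasLinearMassLoss u m T) (hτ : 0 < τ) (hτt : τ ≤ t) (ht : t < T) (c : Plane) :
    Tendsto (fun N => (∫ p, |logExcess u c p| * annulusWeight c N p.1 ∂(stripMeasure τ t)) / N)
      atTop (𝓝 0) := by
  have hτ' : τ ∈ Ioo 0 T := ⟨hτ, hτt.trans_lt ht⟩
  have ht' : t ∈ Ioo 0 T := ⟨hτ.trans_le hτt, ht⟩
  have h1 : Tendsto (fun N => ∫ x, u x t * cutoff c N x - u x τ * cutoff c N x) atTop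
      (𝓝 (-(4 * Real.pi * (t - τ)))) := by
    have h := tendsto_integral_mul_cutoff c ((hm t ht').1.sub (hm τ hτ').1)
    have e : ∫ x, ((fun x => u x t) - fun x => u x τ) x = -(4 * Real.pi * (t - τ)) := by
      have := integral_sub (hm t ht').1 (hm τ hτ').1
      simp only [Pi.sub_apply]
      rw [this, (hm t ht').2, (hm τ hτ').2]
      ring
    rw [e] at h
    simpa only [Pi.sub_apply, sub_mul] using h
  have hdiv : ∀ K : ℝ, Tendsto (fun N : ℝ => K / N) atTop (𝓝 0) := fun K =>
    tendsto_const_nhds.div_atTop tendsto_id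
  have h2 : Tendsto (fun N => 2 * (8 * m * (t - τ)) / N -
      ((∫ x, u x t * cutoff c N x - u x τ * cutoff c N x) + 4 * Real.pi * (t - τ) +
      (∫ p, logExcess u c p * annulusWeight c 0 p.1 ∂(stripMeasure τ t)) / N)) atTop (𝓝 0) := by
    have := (hdiv (2 * (8 * m * (t - τ)))).sub
      ((h1.add_const (4 * Real.pi * (t - τ))).add
        (hdiv (∫ p, logExcess u c p * annulusWeight c 0 p.1 ∂(stripMeasure τ t))))
    simpa using this
  refine tendsto_of_tendsto_of_tendsto_of_le_of_le' tendsto_const_nhds h2 ?_ ?_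
  · filter_upwards [eventually_gt_atTop 0] with N hN
    exact div_nonneg (integral_nonneg fun p =>
      mul_nonneg (abs_nonneg _) (annulusWeight_nonneg _ _ _)) hN.le
  · filter_upwards [eventually_gt_atTop 0] with N hN
    rw [← hu.integral_logExcess_mul hτ hτt ht c hN, ← sub_div]
    refine div_le_div_of_nonneg_right ?_ hN.le
    have i1 := hu.integrable_posPart_logExcess_mul hτ ht c hN.le
    have i2 := hu.integrable_logExcess_mul hτ ht c hN.le
    -- The identity `|a| = 2 a₊ - a` replaces a lower bound on `u` at infinity: the integral of the
    -- positive part is bounded uniformly in `N`, and the signed integral divided by `N` tends to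
    -- zero by the mass law.
    have e : ∫ p, |logExcess u c p| * annulusWeight c N p.1 ∂(stripMeasure τ t) =
        2 * (∫ p, max (logExcess u c p) 0 * annulusWeight c N p.1 ∂(stripMeasure τ t)) -
        ∫ p, logExcess u c p * annulusWeight c N p.1 ∂(stripMeasure τ t) := by
      rw [← integral_const_mul, ← integral_sub (i1.const_mul 2) i2]
      refine integral_congr_ae (Eventually.of_forall fun p => ?_)
      simp only
      rw [← mul_assoc, ← sub_mul]
      congr 1
      rcases le_total (logExcess u c p) 0 with h | h
      · rw [abs_of_nonpos h, max_eq_right h]; ring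
      · rw [abs_of_nonneg h, max_eq_left h]; ring
    rw [e]
    have := hu.integral_posPart_logExcess_mul_le hm hτ hτt ht c hN.le
    linarith

/-! ### `L¹` comparison on open sets -/

lemma IsRegularSolution.integrable_abs_logExcess_mul (hu : IsRegularSolution u T)
    (hτ : 0 < τ) (ht : t < T) (c : Plane) {a : ℝ} (ha : 0 ≤ a) :
    Integrable (fun p => |logExcess u c p| * annulusWeight c a p.1) (stripMeasure τ t) := by
  have := (hu.integrable_logExcess_mul hτ ht c ha).abs
  simpa only [abs_mul, abs_of_nonneg (annulusWeight_nonneg c a _)] using this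

/-- Two solutions with linear mass loss satisfy the comparison principle in an arbitrary open set,
in the form of an `L¹` estimate. -/
lemma IsRegularSolution.integral_posPart_antitone {m' : ℝ} (hu : IsRegularSolution u T)
    (hv : IsRegularSolution v T) (hmu : HasLinearMassLoss u m T) (hmv : HasLinearMassLoss v m' T)
    (hτ : 0 < τ) (hτt : τ ≤ t) (ht : t < T) {H : Set Plane} (hH : IsOpen H)
    (hfr : ∀ x ∈ frontier H, ∀ s ∈ Ioo 0 T, v x s ≤ u x s) :
    ∫ x in H, max (v x t - u x t) 0 ≤ ∫ x in H, max (v x τ - u x τ) 0 := by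
  have hτ' : τ ∈ Ioo 0 T := ⟨hτ, hτt.trans_lt ht⟩
  have ht' : t ∈ Ioo 0 T := ⟨hτ.trans_le hτt, ht⟩
  have hi : ∀ s ∈ Ioo 0 T, IntegrableOn (fun x => max (v x s - u x s) 0) H := fun s hs =>
    (((hmv s hs).1.sub (hmu s hs).1).pos_part).integrableOn
  have h1 := tendsto_integral_mul_cutoff 0 ((hi t ht').sub (hi τ hτ'))
  have h2 := (hu.tendsto_integral_abs_logExcess hmu hτ hτt ht 0).add
    (hv.tendsto_integral_abs_logExcess hmv hτ hτt ht 0)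
  rw [add_zero] at h2
  have key := le_of_tendsto_of_tendsto h1 h2 ?_
  · simp only [Pi.sub_apply] at key
    rw [integral_sub (hi t ht') (hi τ hτ')] at key
    linarith
  filter_upwards [eventually_gt_atTop 0] with N hN
  have hk := hu.integral_posPart_le hv hτ hτt ht hH hfr (contDiff_cutoff 0 hN.le)
    (hasCompactSupport_cutoff 0 hN) (cutoff_nonneg 0 hN)
  have iu := hu.integrable_abs_logExcess_mul hτ ht (0 : Plane) hN.le
  have iv := hv.integrable_abs_logExcess_mul hτ ht (0 : Plane) hN.le
  simp only [Pi.sub_apply, sub_mul]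
  refine hk.trans ?_
  rw [← add_div, ← integral_add iu iv, ← integral_div]
  have hnn : ∀ p : Plane × ℝ, 0 ≤ (|logExcess u 0 p| * annulusWeight 0 N p.1 +
      |logExcess v 0 p| * annulusWeight 0 N p.1) / N := fun p =>
    div_nonneg (add_nonneg (mul_nonneg (abs_nonneg _) (annulusWeight_nonneg _ _ _))
      (mul_nonneg (abs_nonneg _) (annulusWeight_nonneg _ _ _))) hN.le
  -- The terms `log ‖x‖²` cancel in the difference of the two excesses, and the inner annulus enters
  -- with a negative sign, so it can be dropped.
  have hle : ∀ p : Plane × ℝ, H.indicator (fun x => max (Real.log (v x p.2) -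
      Real.log (u x p.2)) 0 * Laplacian.laplacian (cutoff 0 N) x) p.1 ≤
      (|logExcess u 0 p| * annulusWeight 0 N p.1 +
      |logExcess v 0 p| * annulusWeight 0 N p.1) / N := by
    intro p
    by_cases hp : p.1 ∈ H
    swap
    · rw [indicator_of_notMem hp]; exact hnn p
    rw [indicator_of_mem hp, laplacian_cutoff 0 hN, ← add_mul]
    have hmax : max (Real.log (v p.1 p.2) - Real.log (u p.1 p.2)) 0 ≤
        |logExcess u 0 p| + |logExcess v 0 p| := by
      refine max_le ?_ (add_nonneg (abs_nonneg _) (abs_nonneg _))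
      have e : Real.log (v p.1 p.2) - Real.log (u p.1 p.2) =
          logExcess v 0 p - logExcess u 0 p := by
        simp only [logExcess]; ring
      rw [e]
      linarith [le_abs_self (logExcess v 0 p), neg_abs_le (logExcess u 0 p)]
    calc max (Real.log (v p.1 p.2) - Real.log (u p.1 p.2)) 0 *
          ((annulusWeight 0 N p.1 - annulusWeight 0 0 p.1) / N)
        ≤ max (Real.log (v p.1 p.2) - Real.log (u p.1 p.2)) 0 * (annulusWeight 0 N p.1 / N) := by
          refine mul_le_mul_of_nonneg_left (div_le_div_of_nonneg_right ?_ hN.le)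
            (le_max_right _ _)
          linarith [annulusWeight_nonneg 0 0 p.1]
      _ ≤ (|logExcess u 0 p| + |logExcess v 0 p|) * (annulusWeight 0 N p.1 / N) :=
          mul_le_mul_of_nonneg_right hmax (div_nonneg (annulusWeight_nonneg _ _ _) hN.le)
      _ = _ := by ring
  by_cases hint : Integrable (fun p : Plane × ℝ => H.indicator (fun x => max (Real.log (v x p.2) -
      Real.log (u x p.2)) 0 * Laplacian.laplacian (cutoff 0 N) x) p.1) (stripMeasure τ t)
  · exact integral_mono hint ((iu.add iv).div_const N) hle
  -- A nonintegrable function has integral `0` by convention, so the bound still holds.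
  · rw [integral_undef hint]
    exact integral_nonneg hnn

end

/-! ### Convergence to the initial value -/

/-- Write `|a - b| = (a - b) + 2 (b - a)₊` with `a = u(·,τ)` and `b = u₀`. The first term has
integral `-4πτ ≤ 0`. The second is small on compact sets by hypothesis, and elsewhere at most `2
u₀`, whose tail is small. -/
lemma HasInitialValue.tendsto_integral_abs_sub {u : Plane → ℝ → ℝ} {u₀ : Plane → ℝ} {T : ℝ}
    (hT : 0 < T) (hu : IsRegularSolution u T) (hm : HasLinearMassLoss u (∫ x, u₀ x) T)
    (h0 : HasInitialValue u u₀) (hu₀ : Integrable u₀) (hnn : 0 ≤ᵐ[volume] u₀) :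
    Tendsto (fun τ => ∫ x, |u x τ - u₀ x|) (𝓝[>] 0) (𝓝 0) := by
  have hloc : ∀ K : Set Plane, IsCompact K →
      Tendsto (fun τ => ∫ x in K, |u x τ - u₀ x|) (𝓝[>] 0) (𝓝 0) := by
    intro K hK
    have h := (ENNReal.tendsto_toReal ENNReal.zero_ne_top).comp (h0 K hK)
    rw [ENNReal.toReal_zero] at h
    refine h.congr' ?_
    filter_upwards [Ioo_mem_nhdsGT hT] with τ hτ
    have hi : IntegrableOn (fun x => u x τ - u₀ x) K := ((hm τ hτ).1.sub hu₀).integrableOn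
    simp only [Function.comp_apply, eLpNorm_one_eq_lintegral_enorm]
    rw [← integral_norm_eq_lintegral_enorm hi.1]
    rfl
  have hkey : ∀ N > 0, ∀ τ ∈ Ioo 0 T, ∫ x, |u x τ - u₀ x| ≤
      2 * (∫ x in tsupport (cutoff 0 N), |u x τ - u₀ x|) +
      2 * ((∫ x, u₀ x) - ∫ x, u₀ x * cutoff 0 N x) := by
    intro N hN τ hτ
    obtain ⟨hi, hI⟩ := hm τ hτ
    have hd := (hi.sub hu₀).abs
    have hcut : Integrable fun x => u₀ x * cutoff 0 N x :=
      hu₀.mul_bdd (c := 1) (contDiff_cutoff 0 hN.le).continuous.aestronglyMeasurable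
        (Eventually.of_forall fun x => by
          rw [Real.norm_eq_abs, abs_of_nonneg (cutoff_nonneg 0 hN x)]
          exact cutoff_le_one 0 hN x)
    have hKm : MeasurableSet (tsupport (cutoff (0 : Plane) N)) :=
      (isClosed_tsupport _).measurableSet
    have hind : Integrable ((tsupport (cutoff (0 : Plane) N)).indicator
        fun x => |u x τ - u₀ x|) := hd.indicator hKm
    have hle : ∫ x, |u x τ - u₀ x| ≤ ∫ x, ((u x τ - u₀ x) +
        2 * ((tsupport (cutoff (0 : Plane) N)).indicator (fun x => |u x τ - u₀ x|) x +
          (u₀ x - u₀ x * cutoff 0 N x))) := by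
      refine integral_mono_ae hd ((hi.sub hu₀).add ((hind.add (hu₀.sub hcut)).const_mul 2)) ?_
      filter_upwards [hnn] with x hx
      have hx0 : 0 ≤ u₀ x := hx
      have hup := hu.pos x τ hτ
      have c0 := cutoff_nonneg 0 hN x
      have c1 := cutoff_le_one 0 hN x
      by_cases hxK : x ∈ tsupport (cutoff (0 : Plane) N)
      · rw [indicator_of_mem hxK]
        rcases abs_cases (u x τ - u₀ x) with ⟨h, _⟩ | ⟨h, _⟩ <;> rw [h] <;> nlinarith
      · rw [indicator_of_notMem hxK, image_eq_zero_of_notMem_tsupport hxK]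
        rcases abs_cases (u x τ - u₀ x) with ⟨h, _⟩ | ⟨h, _⟩ <;> rw [h] <;> nlinarith
    refine hle.trans ?_
    have j1 : Integrable fun x => u x τ - u₀ x := hi.sub hu₀
    have j2 : Integrable fun x => u₀ x - u₀ x * cutoff 0 N x := hu₀.sub hcut
    have j3 : Integrable fun x => 2 * ((tsupport (cutoff (0 : Plane) N)).indicator
        (fun x => |u x τ - u₀ x|) x + (u₀ x - u₀ x * cutoff 0 N x)) := (hind.add j2).const_mul 2
    rw [integral_add j1 j3, integral_const_mul, integral_add hind j2, integral_sub hu₀ hcut, integral_indicator hKm,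
      integral_sub hi hu₀, hI]
    nlinarith [Real.pi_pos, hτ.1]
  rw [Metric.tendsto_nhds]
  intro ε hε
  have h1 : ∀ᶠ N in atTop, (∫ x, u₀ x) - ∫ x, u₀ x * cutoff 0 N x < ε / 4 := by
    have := (tendsto_integral_mul_cutoff 0 hu₀).const_sub (∫ x, u₀ x)
    rw [sub_self] at this
    exact this.eventually (gt_mem_nhds (by linarith))
  obtain ⟨N, hN, hN0⟩ := (h1.and (eventually_gt_atTop 0)).exists
  filter_upwards [Ioo_mem_nhdsGT hT, (hloc _ (hasCompactSupport_cutoff 0 hN0)).eventually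
    (gt_mem_nhds (show (0 : ℝ) < ε / 4 by linarith))] with τ hτ h2
  rw [Real.dist_eq, sub_zero, abs_of_nonneg (integral_nonneg fun x => abs_nonneg _)]
  linarith [hkey N hN0 τ hτ]

/-! ### Reflections -/

/-- The reflection of the plane in the line through `c` orthogonal to `n`. -/
noncomputable def planeReflection (n c z : Plane) : Plane :=
  (ℝ ∙ n)ᗮ.reflection (z - c) + c

lemma planeReflection_eq (n c z : Plane) :
    planeReflection n c z = z - (2 * (inner ℝ n (z - c) / ‖n‖ ^ 2)) • n := by
  rw [planeReflection, Submodule.reflection_orthogonal_apply, Submodule.reflection_singleton_apply]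
  simp only [RCLike.ofReal_real_eq_id, id_eq]
  module

lemma measurePreserving_planeReflection (n c : Plane) :
    MeasurePreserving (planeReflection n c) volume volume :=
  (measurePreserving_add_right volume c).comp
    ((ℝ ∙ n)ᗮ.reflection.measurePreserving.comp (measurePreserving_sub_right volume c))

lemma measurableEmbedding_planeReflection (n c : Plane) :
    MeasurableEmbedding (planeReflection n c) :=
  (Homeomorph.addRight c).measurableEmbedding.comp
    ((ℝ ∙ n)ᗮ.reflection.toHomeomorph.measurableEmbedding.comp
      (Homeomorph.subRight c).measurableEmbedding)

/-- The sign of this quantity tells on which side of the bisector the origin lies; divided by `‖y -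
x‖` it is the signed distance from the origin to the bisector. -/
lemma inner_sub_midpoint (x y : Plane) :
    inner ℝ (y - x) (midpoint ℝ x y) = (‖y‖ ^ 2 - ‖x‖ ^ 2) / 2 := by
  rw [midpoint_eq_smul_add, inner_smul_right, inner_sub_left, inner_add_right, inner_add_right,
    real_inner_self_eq_norm_sq, real_inner_self_eq_norm_sq, real_inner_comm x y]
  simp
  ring

/-- The reflection in the bisector of `x` and `y` moves points away from the origin, if the
origin is on the side of `x`. -/
lemma norm_le_norm_planeReflection {x y z : Plane} (hxy : ‖x‖ ≤ ‖y‖)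
    (hz : inner ℝ (y - x) (z - midpoint ℝ x y) < 0) :
    ‖z‖ ≤ ‖planeReflection (y - x) (midpoint ℝ x y) z‖ := by
  set n := y - x
  set c := midpoint ℝ x y
  have hc : 0 ≤ inner ℝ n c := by
    rw [inner_sub_midpoint]
    nlinarith [norm_nonneg x]
  set k := inner ℝ n (z - c) / ‖n‖ ^ 2 with hk
  have hk0 : k ≤ 0 := div_nonpos_of_nonpos_of_nonneg hz.le (by positivity)
  have hn : ‖n‖ ^ 2 ≠ 0 := by
    intro h
    have : n = 0 := by simpa using h
    rw [this, inner_zero_left] at hz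
    exact lt_irrefl _ hz
  have hkn : k * ‖n‖ ^ 2 = inner ℝ n z - inner ℝ n c := by
    rw [hk, div_mul_cancel₀ _ hn, inner_sub_right]
  refine le_of_sq_le_sq ?_ (norm_nonneg _)
  rw [planeReflection_eq, ← hk, norm_sub_sq_real, inner_smul_right, norm_smul, mul_pow, Real.norm_eq_abs,
    sq_abs, real_inner_comm]
  -- With this, `‖σ z‖² - ‖z‖²` collapses to `-4 k ⟪n, c⟫`, where `k ≤ 0 ≤ ⟪n, c⟫`.
  have : (2 * k) ^ 2 * ‖n‖ ^ 2 = 4 * k * (inner ℝ n z - inner ℝ n c) := by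
    rw [← hkn]; ring
  rw [this]
  nlinarith

/-- As `‖y - x‖ ≤ ‖x‖ + ‖y‖`, the bisector has distance at least `(‖y‖ - ‖x‖) / 2 ≥ r` from the
origin, and the reflected point lies beyond it. This explains the `2 * r₂` in the theorem. -/
lemma le_norm_planeReflection {x y z : Plane} {r : ℝ} (hxy : ‖x‖ + 2 * r ≤ ‖y‖) (hr : 0 ≤ r)
    (hz : inner ℝ (y - x) (z - midpoint ℝ x y) < 0) :
    r ≤ ‖planeReflection (y - x) (midpoint ℝ x y) z‖ := by
  have hn0 : y - x ≠ 0 := by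
    intro h
    rw [h, inner_zero_left] at hz
    exact lt_irrefl _ hz
  have hnp : 0 < ‖y - x‖ := norm_pos_iff.2 hn0
  have h1 := real_inner_le_norm (y - x) (planeReflection (y - x) (midpoint ℝ x y) z)
  have h2 : inner ℝ (y - x) (planeReflection (y - x) (midpoint ℝ x y) z) =
      inner ℝ (y - x) (midpoint ℝ x y) - inner ℝ (y - x) (z - midpoint ℝ x y) := by
    rw [planeReflection_eq, inner_sub_right, inner_smul_right, real_inner_self_eq_norm_sq]
    have : 2 * (inner ℝ (y - x) (z - midpoint ℝ x y) / ‖y - x‖ ^ 2) * ‖y - x‖ ^ 2 =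
        2 * inner ℝ (y - x) (z - midpoint ℝ x y) := by
      field_simp
    rw [this, inner_sub_right]
    ring
  rw [h2, inner_sub_midpoint] at h1
  have h3 := norm_sub_le y x
  have h4 : r * ‖y - x‖ ≤ (‖y‖ ^ 2 - ‖x‖ ^ 2) / 2 := by
    nlinarith [norm_nonneg x, norm_nonneg y]
  nlinarith

lemma planeReflection_left (x y : Plane) :
    planeReflection (y - x) (midpoint ℝ x y) x = y := by
  rcases eq_or_ne x y with rfl | h
  · simp [planeReflection]
  have hn : ‖y - x‖ ^ 2 ≠ 0 := pow_ne_zero 2 (norm_ne_zero_iff.2 (sub_ne_zero.2 h.symm))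
  rw [planeReflection_eq, left_sub_midpoint, inner_smul_right, ← neg_sub y x, inner_neg_right,
    real_inner_self_eq_norm_sq]
  have : 2 * (((⅟2 : ℝ) * -‖y - x‖ ^ 2) / ‖y - x‖ ^ 2) = -1 := by
    generalize ‖y - x‖ ^ 2 = a at hn
    rw [invOf_eq_inv]
    field_simp
  rw [this]
  module

/-- The initial value is larger than its reflection on the side of the bisector that contains
the origin. -/
lemma ae_comp_planeReflection_le {u₀ : Plane → ℝ} {r₁ r₂ : ℝ} (hr₁ : 0 < r₁) (hr₁₂ : r₁ < r₂)
    (hu₀ : MemLp u₀ ⊤ volume) (hrad : IsRadialDecreasingFrom u₀ r₁)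
    (hess : essSup u₀ (volume.restrict (Metric.ball (0 : Plane) r₂)ᶜ) ≤
      essInf u₀ (volume.restrict (Metric.closedBall (0 : Plane) r₁)))
    {x y : Plane} (hxy : ‖x‖ + 2 * r₂ ≤ ‖y‖) :
    ∀ᵐ z ∂(volume : Measure Plane), inner ℝ (y - x) (z - midpoint ℝ x y) < 0 →
      u₀ (planeReflection (y - x) (midpoint ℝ x y) z) ≤ u₀ z := by
  -- The real-valued `essSup` and `essInf` bound the function almost everywhere only in the presence
  -- of such an essential bound.
  obtain ⟨C, hC⟩ : ∃ C : ℝ, ∀ᵐ z ∂(volume : Measure Plane), |u₀ z| ≤ C := by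
    have h := ae_le_eLpNormEssSup (f := u₀) (μ := (volume : Measure Plane))
    have hfin : eLpNormEssSup u₀ (volume : Measure Plane) ≠ ⊤ := by
      rw [← eLpNorm_exponent_top]; exact hu₀.2.ne
    refine ⟨(eLpNormEssSup u₀ volume).toReal, ?_⟩
    filter_upwards [h] with z hz
    rw [← Real.norm_eq_abs, ← toReal_enorm]
    exact ENNReal.toReal_mono hfin hz
  have hsup : ∀ᵐ z ∂(volume : Measure Plane), z ∈ (Metric.ball (0 : Plane) r₂)ᶜ →
      u₀ z ≤ essSup u₀ (volume.restrict (Metric.ball (0 : Plane) r₂)ᶜ) := by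
    rw [← ae_restrict_iff' Metric.isOpen_ball.measurableSet.compl]
    refine ae_le_essSup ⟨C, ?_⟩
    rw [eventually_map]
    filter_upwards [ae_restrict_of_ae hC] with z hz
    exact (le_abs_self _).trans hz
  have hinf : ∀ᵐ z ∂(volume : Measure Plane), z ∈ Metric.closedBall (0 : Plane) r₁ →
      essInf u₀ (volume.restrict (Metric.closedBall (0 : Plane) r₁)) ≤ u₀ z := by
    rw [← ae_restrict_iff' Metric.isClosed_closedBall.measurableSet]
    refine ae_essInf_le ⟨-C, ?_⟩
    rw [eventually_map]
    filter_upwards [ae_restrict_of_ae hC] with z hz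
    exact (abs_le.1 hz).1
  obtain ⟨φ, hφ, hrad⟩ := hrad
  filter_upwards [hinf, (measurePreserving_planeReflection (y - x)
    (midpoint ℝ x y)).quasiMeasurePreserving.ae hsup] with z hz hσ hH
  have h1 := norm_le_norm_planeReflection (by linarith) hH
  have h2 := le_norm_planeReflection hxy (by linarith) hH
  -- If `r₁ ≤ ‖z‖`, radial monotonicity applies to `z` and to its image farther out. Otherwise `z`
  -- lies in the inner ball and its image outside the ball of radius `r₂`, and the hypothesis on
  -- `essInf` and `essSup` applies.
  rcases le_total r₁ ‖z‖ with h | h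
  · rw [hrad z h, hrad _ (h.trans h1)]
    exact hφ h (h.trans h1) h1
  · refine (hσ ?_).trans (hess.trans (hz ?_))
    · simpa using h2
    · simpa using h

/-! ### The main result -/

/-- The comparison of a maximal solution with its reflection. -/
lemma IsMaximalSolution.le_of_norm_add_le {u₀ : Plane → ℝ} {u : Plane → ℝ → ℝ} {r₁ r₂ T : ℝ}
    (hr₁ : 0 < r₁) (hr₁₂ : r₁ < r₂) (hnn : 0 ≤ᵐ[volume] u₀) (hL1 : Integrable u₀)
    (hLinf : MemLp u₀ ⊤ volume) (hrad : IsRadialDecreasingFrom u₀ r₁)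
    (hess : essSup u₀ (volume.restrict (Metric.ball (0 : Plane) r₂)ᶜ) ≤
      essInf u₀ (volume.restrict (Metric.closedBall (0 : Plane) r₁)))
    (hu : IsMaximalSolution u u₀ T) {t : ℝ} (ht : t ∈ Ioo 0 T) {x y : Plane}
    (hxy : ‖x‖ + 2 * r₂ ≤ ‖y‖) : u y t ≤ u x t := by
  set n := y - x with hn
  set c := midpoint ℝ x y with hc
  set σ := planeReflection n c with hσ
  set H : Set Plane := {z | inner ℝ n (z - c) < 0} with hH
  have hn0 : 0 < ‖n‖ := by
    rw [norm_pos_iff, hn, sub_ne_zero]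
    rintro rfl
    linarith
  have hHo : IsOpen H := isOpen_lt (by fun_prop) continuous_const
  have hxH : x ∈ H := by
    have : inner ℝ n (x - c) = -(‖n‖ ^ 2 / 2) := by
      rw [hc, left_sub_midpoint, ← neg_sub y x, ← hn, inner_smul_right, inner_neg_right,
        real_inner_self_eq_norm_sq, invOf_eq_inv]
      ring
    simp only [hH, mem_ofPred_eq, this]
    nlinarith
  have hmp : MeasurePreserving σ volume volume := measurePreserving_planeReflection n c
  have hme : MeasurableEmbedding σ := measurableEmbedding_planeReflection n c
  have hru := hu.classical.isRegularSolution
  have hmu := hu.massLoss.hasLinearMassLoss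
  have hrv : IsRegularSolution (fun z s => u (σ z) s) T := hru.comp_isometry _ c
  have hmv : HasLinearMassLoss (fun z s => u (σ z) s) (∫ x, u₀ x) T := fun s hs =>
    ⟨(hmp.integrable_comp_emb hme).2 (hmu s hs).1,
      (hmp.integral_comp hme fun z => u z s).trans (hmu s hs).2⟩
  have hfr : ∀ z ∈ frontier H, ∀ s ∈ Ioo 0 T, u (σ z) s ≤ u z s := by
    intro z hz s _
    have h0 : inner ℝ n (z - c) = 0 :=
      frontier_lt_subset_eq (f := fun z => inner ℝ n (z - c)) (g := fun _ => (0 : ℝ))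
        (by fun_prop) continuous_const hz
    rw [hσ, planeReflection_eq, h0]
    simp
  have hT : 0 < T := ht.1.trans ht.2
  have hlim := (hu.initial.tendsto_integral_abs_sub hT hru hmu hL1 hnn).const_mul 2
  rw [mul_zero] at hlim
  -- Monotonicity in time reduces the claim to times `τ` near zero. There `u₀ ∘ σ ≤ u₀` on `H`
  -- bounds the integral by twice the `L¹` distance from `u(·,τ)` to `u₀`, as `σ` preserves measure.
  have hzero : ∫ z in H, max (u (σ z) t - u z t) 0 ≤ 0 := by
    refine ge_of_tendsto hlim ?_
    filter_upwards [Ioo_mem_nhdsGT ht.1] with τ hτ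
    have hτT : τ ∈ Ioo 0 T := ⟨hτ.1, hτ.2.trans ht.2⟩
    refine (hru.integral_posPart_antitone hrv hmu hmv hτ.1 hτ.2.le ht.2 hHo hfr).trans ?_
    have hd : Integrable fun z => |u z τ - u₀ z| := ((hmu τ hτT).1.sub hL1).abs
    have hdσ : Integrable fun z => |u (σ z) τ - u₀ (σ z)| :=
      (hmp.integrable_comp_emb hme).2 hd
    have hsum : (2 : ℝ) * ∫ z, |u z τ - u₀ z| =
        ∫ z, (|u (σ z) τ - u₀ (σ z)| + |u z τ - u₀ z|) := by
      rw [integral_add hdσ hd, hmp.integral_comp hme fun z => |u z τ - u₀ z|]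
      ring
    rw [hsum]
    refine le_trans ?_ (setIntegral_le_integral (s := H) (hdσ.add hd)
      (Eventually.of_forall fun z => add_nonneg (abs_nonneg _) (abs_nonneg _)))
    refine setIntegral_mono_on_ae (((hmv τ hτT).1.sub (hmu τ hτT).1).pos_part).integrableOn
      (hdσ.add hd).integrableOn hHo.measurableSet ?_
    filter_upwards [ae_comp_planeReflection_le hr₁ hr₁₂ hLinf hrad hess hxy] with z hz hzH
    have := hz hzH
    refine max_le ?_ (add_nonneg (abs_nonneg _) (abs_nonneg _))
    linarith [le_abs_self (u (σ z) τ - u₀ (σ z)), neg_abs_le (u z τ - u₀ z)]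
  have hnn' : 0 ≤ᵐ[volume.restrict H] fun z => max (u (σ z) t - u z t) 0 :=
    Eventually.of_forall fun z => le_max_right _ _
  have hae := (setIntegral_eq_zero_iff_of_nonneg_ae hnn'
    (((hmv t ht).1.sub (hmu t ht).1).pos_part).integrableOn).1
    (le_antisymm hzero (integral_nonneg fun z => le_max_right _ _))
  have hcu := (hru.contDiff_space t ht).continuous
  have hcv := (hrv.contDiff_space t ht).continuous
  -- Continuity upgrades the a.e. inequality on `H` to every point, in particular `x`.
  have hEq := Measure.eqOn_open_of_ae_eq hae hHo
    ((hcv.sub hcu).max continuous_const).continuousOn continuousOn_const hxH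
  have hle := max_eq_right_iff.1 hEq
  have hy : σ x = y := planeReflection_left x y
  rw [hy] at hle
  linarith

end LogDiffusion

theorem lemma1p1 (u₀ : LogDiffusion.Plane → ℝ) (u : LogDiffusion.Plane → ℝ → ℝ) (r₁ r₂ T : ℝ)
    (hr₁ : 0 < r₁) (hr₁₂ : r₁ < r₂)
    (hu₀_nonneg : 0 ≤ᵐ[volume] u₀) (hu₀_L1 : MemLp u₀ 1 volume) (hu₀_Linfty : MemLp u₀ ⊤ volume)
    (hu₀_radial : LogDiffusion.IsRadialDecreasingFrom u₀ r₁)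
    (hu₀_ess : essSup u₀ (volume.restrict (Metric.ball (0 : LogDiffusion.Plane) r₂)ᶜ) ≤
      essInf u₀ (volume.restrict (Metric.closedBall (0 : LogDiffusion.Plane) r₁)))
    (hu : LogDiffusion.IsMaximalSolution u u₀ T) :
    (∀ t ∈ Ioo (0 : ℝ) T, ∀ x y : LogDiffusion.Plane, ‖x‖ + 2 * r₂ ≤ ‖y‖ → u y t ≤ u x t) ∧
    (∀ t ∈ Ioo (0 : ℝ) T, ∃ z ∈ Metric.closedBall (0 : LogDiffusion.Plane) (2 * r₂),
      ∀ x : LogDiffusion.Plane, u x t ≤ u z t) := by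
  have key : ∀ t ∈ Ioo (0 : ℝ) T, ∀ x y : LogDiffusion.Plane, ‖x‖ + 2 * r₂ ≤ ‖y‖ → u y t ≤ u x t :=
    fun t ht x y hxy => hu.le_of_norm_add_le hr₁ hr₁₂ hu₀_nonneg (memLp_one_iff_integrable.1 hu₀_L1)
      hu₀_Linfty hu₀_radial hu₀_ess ht hxy
  refine ⟨key, fun t ht => ?_⟩
  have h0 : (0 : LogDiffusion.Plane) ∈ Metric.closedBall (0 : LogDiffusion.Plane) (2 * r₂) :=
    Metric.mem_closedBall_self (by linarith)
  obtain ⟨z, hz, hmax⟩ := (isCompact_closedBall (0 : LogDiffusion.Plane) (2 * r₂)).exists_isMaxOn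
    ⟨0, h0⟩ (hu.classical.contDiff_space t ht).continuous.continuousOn
  refine ⟨z, hz, fun x => ?_⟩
  -- A maximum point over the compact ball is global: any point outside is compared with the origin.
  rcases le_total ‖x‖ (2 * r₂) with h | h
  · exact hmax (by simpa using h)
  · exact (key t ht 0 x (by simpa using h)).trans (hmax h0)
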